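/- Let $\Gamma$ be a finite abelian group and let $S \subseteq \Gamma$ be a set that does not contain the identity and is closed under taking inverses. Let $X = \mathrm{Cay}(\Gamma, S)$ be the Cayley graph with vertex set $\Gamma$ in which $g$ and $h$ are adjacent if and only if $g = hs$ for some $s \in S$. If $X$ is connected and $5$-regular, then $X$ has a decomposition into two Hamilton cycles and a perfect matching; that is, there are two Hamilton cycles $H_1, H_2$ of $X$ and a perfect matching $F$ of $X$ such that the edge sets of $H_1$, $H_2$ and $F$ are pairwise disjoint and their union is the edge set of $X$. -/

import Mathlib

/-- The edges of `G` are partitioned into the edge sets of two Hamilton cycles and a perfect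
matching. -/
def SimpleGraph.HasTwoHamiltonCyclesMatchingDecomposition {V : Type*} [DecidableEq V]
    (G : SimpleGraph V) : Prop :=
  ∃ (u v : V) (p : G.Walk u u) (q : G.Walk v v) (M : G.Subgraph),
    p.IsHamiltonianCycle ∧ q.IsHamiltonianCycle ∧ M.IsPerfectMatching ∧
    Disjoint p.edgeSet q.edgeSet ∧ Disjoint p.edgeSet M.edgeSet ∧ Disjoint q.edgeSet M.edgeSet ∧
    p.edgeSet ∪ q.edgeSet ∪ M.edgeSet = G.edgeSet

/-! A set `S` of five elements closed under inverses contains an involution `e`. The other four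
elements form a set `T`. They are two inverse pairs, or one inverse pair and two involutions, or
four involutions. A pair of involutions `a`, `b` can act like an inverse pair, because the walk
alternating between the steps `a` and `b` plays the role of the powers of one element
(`IsPairWalk`). If `e` is chosen well, two such walks identify each component of the Cayley graph of
`T` with a Cayley graph of a quotient of `ℤ × ℤ` with connection set `{r, -r, s, -s}`
(`exists_spanningCycles_of_isPairWalk`).

That graph is a twisted torus grid, and it splits into two Hamilton cycles
(`exists_decomposition_of_two_generators`). Start from all row edges on one side and all column
edges on the other, and exchange the two kinds of edges around some squares. If no two chosen
squares share a side, both sides stay `2`-regular. The squares climb a diagonal and then zigzag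
between two adjacent pairs of columns, so that one switch set merges the rows into one cycle and
also the columns into one cycle. Parity matters: joining cycles in a path always merges them, while
joining them cyclically does so for an odd number of cycles.

Let `K` be the subgroup generated by `T`. If `e` lies in `K`, the edges of `e` form the matching.
Otherwise the graph is a prism over the component `K`, and each Hamilton cycle is doubled by trading
one edge in both copies for two rungs (`hasSpanningDecomposition_prism`). The traded edges and the
unused rungs form the matching. -/

section Chain

/-! ### Connectivity of rows joined by switches -/

variable {A : Type*} [AddCommGroup A] {R : A → A → Prop} {r s : A}

/-- The multiple is positive, so a walk along the coset can start at `p + r`, just beyond the cut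
edge from `p` to `p + r`, and reach `p` at the end of the turn. -/
lemma exists_nsmul_of_sub_mem_zmultiples [Finite A] {x p : A} (h : x - p ∈ AddSubgroup.zmultiples r) :
    ∃ t : ℕ, x = p + (t + 1) • r := by
  have h' : x - p - r ∈ AddSubgroup.zmultiples r :=
    sub_mem h (AddSubgroup.mem_zmultiples r)
  rw [← mem_multiples_iff_mem_zmultiples] at h'
  obtain ⟨t, ht⟩ := h'
  refine ⟨t, ?_⟩
  simp only at ht
  rw [add_smul, one_smul, ht]
  abel

lemma nsmul_mem_coset (p : A) (t : ℕ) : p + t • r - p ∈ AddSubgroup.zmultiples r := by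
  rw [add_sub_cancel_left]
  exact nsmul_mem (AddSubgroup.mem_zmultiples r) t

/-- A coset of `⟨r⟩` is a cycle, which stays connected when one edge is removed. -/
lemma coset_related_of_one_cut [Finite A] (hR : Equivalence R) (p : A)
    (h : ∀ x, x - p ∈ AddSubgroup.zmultiples r → x ≠ p → R x (x + r))
    {x : A} (hx : x - p ∈ AddSubgroup.zmultiples r) : R p x := by
  have key : ∀ t : ℕ, R (p + r) (p + (t + 1) • r) := by
    intro t
    induction t with
    | zero => simpa using hR.refl _
    | succ t ih =>
      have e : p + (t + 1 + 1) • r = p + (t + 1) • r + r := by rw [succ_nsmul _ (t + 1)]; abel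
      -- Back at `p`, a full turn is complete, and the next vertex is the starting point `p + r`.
      by_cases hp : p + (t + 1) • r = p
      · rw [e, hp]; exact hR.refl _
      · rw [e]
        exact hR.trans ih (h _ (nsmul_mem_coset _ _) hp)
  have key' : ∀ y, y - p ∈ AddSubgroup.zmultiples r → R (p + r) y := by
    intro y hy
    obtain ⟨t, rfl⟩ := exists_nsmul_of_sub_mem_zmultiples hy
    exact key t
  exact hR.trans (hR.symm (key' p (by simp))) (key' x hx)

/-- Removing two edges from the cycle on a coset of `⟨r⟩` leaves two arcs. -/
lemma coset_related_of_two_cuts [Finite A] (hR : Equivalence R) (p q : A)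
    (hq : q - p ∈ AddSubgroup.zmultiples r)
    (h : ∀ x, x - p ∈ AddSubgroup.zmultiples r → x ≠ p → x ≠ q → R x (x + r)) :
    R (p + r) q := by
  -- If `q` is never related to `p + r`, the walk from `p + r` never stops at the second cut, so it
  -- covers the whole coset, including `q`.
  by_contra hc
  have key : ∀ t : ℕ, R (p + r) (p + (t + 1) • r) := by
    intro t
    induction t with
    | zero => simpa using hR.refl _
    | succ t ih =>
      have e : p + (t + 1 + 1) • r = p + (t + 1) • r + r := by rw [succ_nsmul _ (t + 1)]; abel
      by_cases hp : p + (t + 1) • r = p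
      · rw [e, hp]; exact hR.refl _
      by_cases hp' : p + (t + 1) • r = q
      · exact absurd (hp' ▸ ih) hc
      · rw [e]
        exact hR.trans ih (h _ (nsmul_mem_coset _ _) hp hp')
  obtain ⟨t, ht⟩ := exists_nsmul_of_sub_mem_zmultiples hq
  exact hc (ht ▸ key t)

lemma coset_related_or_of_two_cuts [Finite A] (hR : Equivalence R) (p q : A)
    (h : ∀ x, x - p ∈ AddSubgroup.zmultiples r → x ≠ p → x ≠ q → R x (x + r))
    {x : A} (hx : x - p ∈ AddSubgroup.zmultiples r) : R (p + r) x ∨ R (q + r) x := by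
  obtain ⟨t, rfl⟩ := exists_nsmul_of_sub_mem_zmultiples hx
  clear hx
  induction t with
  | zero => left; simpa using hR.refl _
  | succ t ih =>
    have e : p + (t + 1 + 1) • r = p + (t + 1) • r + r := by rw [succ_nsmul _ (t + 1)]; abel
    by_cases hp : p + (t + 1) • r = p
    · left; rw [e, hp]; exact hR.refl _
    by_cases hp' : p + (t + 1) • r = q
    · right; rw [e, hp']; exact hR.refl _
    · rw [e]
      have h' := h _ (nsmul_mem_coset _ _) hp hp'
      exact ih.imp (fun k => hR.trans k h') (fun k => hR.trans k h')

variable {n : ℕ} {q : ℕ → A}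

lemma row_unique (hn : ∀ k : ℤ, k • s ∈ AddSubgroup.zmultiples r ↔ (n : ℤ) ∣ k) {i j : ℕ}
    (hi : i < n) (hj : j < n) {x : A} (hxi : x - i • s ∈ AddSubgroup.zmultiples r)
    (hxj : x - j • s ∈ AddSubgroup.zmultiples r) : i = j := by
  have h := sub_mem hxi hxj
  have e : x - i • s - (x - j • s) = ((j : ℤ) - i) • s := by
    rw [sub_smul, natCast_zsmul, natCast_zsmul]; abel
  rw [e, hn] at h
  obtain ⟨k, hk⟩ := h
  have : k = 0 := by
    by_contra h0
    rcases lt_or_gt_of_ne h0 with h0 | h0 <;> nlinarith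
  subst this
  omega

lemma row_shift_unique (hn : ∀ k : ℤ, k • s ∈ AddSubgroup.zmultiples r ↔ (n : ℤ) ∣ k) {i j : ℕ}
    (hi : i < n) (hj : j < n) {x : A} (hxi : x - i • s ∈ AddSubgroup.zmultiples r)
    (hxj : x + s - j • s ∈ AddSubgroup.zmultiples r) : i + 1 = j ∨ i + 1 = n ∧ j = 0 := by
  have e : x + s - (i + 1) • s = x - i • s := by rw [succ_nsmul]; abel
  rw [← e] at hxi
  rcases Nat.lt_or_ge (i + 1) n with h | h
  · exact .inl (row_unique hn h hj hxi hxj)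
  · right
    have hin : i + 1 = n := by omega
    refine ⟨hin, (row_unique (i := 0) hn (by omega) hj (x := x + s) ?_ hxj).symm⟩
    have h1 : ((i + 1 : ℕ) : ℤ) • s ∈ AddSubgroup.zmultiples r := by rw [hn, hin]
    have := add_mem hxi h1
    rwa [natCast_zsmul, sub_add_cancel, ← sub_zero (x + s), ← zero_nsmul s] at this

/-- Rows (cosets of `⟨r⟩`) joined in a path by one switch between consecutive rows. -/
lemma chain_linear [Finite A] (hR : Equivalence R)
    (hn : ∀ k : ℤ, k • s ∈ AddSubgroup.zmultiples r ↔ (n : ℤ) ∣ k)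
    (hgen : ∀ x : A, ∃ j < n, x - j • s ∈ AddSubgroup.zmultiples r)
    (hq : ∀ j < n, q j - j • s ∈ AddSubgroup.zmultiples r)
    (h1 : ∀ x, (∀ j, j + 1 < n → x ≠ q j ∧ x ≠ q j + s) → R x (x + r))
    (h2 : ∀ j, j + 1 < n → R (q j) (q j + s))
    (h3 : ∀ j, j + 1 < n → R (q j + r) (q j + r + s)) (x y : A) : R x y := by
  have row : ∀ j < n, ∀ x, x - q j ∈ AddSubgroup.zmultiples r ↔
      x - j • s ∈ AddSubgroup.zmultiples r := fun j hj x => by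
    have e : x - j • s = x - q j + (q j - j • s) := by abel
    rw [e, AddSubgroup.add_mem_cancel_right _ (hq j hj)]
  have key : ∀ j < n, ∀ x, x - j • s ∈ AddSubgroup.zmultiples r → R (q 0) x := by
    intro j
    induction j with
    | zero =>
      intro hj x hx
      refine coset_related_of_one_cut hR (q 0) (fun y hy hne => h1 y fun i hi => ⟨?_, ?_⟩)
        ((row 0 hj x).2 hx)
      · rintro rfl
        rw [row 0 hj] at hy
        rw [row_unique hn (by omega) hj (hq i (by omega)) hy] at hne
        exact hne rfl
      · rintro rfl
        rw [row 0 hj] at hy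
        rcases row_shift_unique hn (by omega) hj (hq i (by omega)) hy with h | h <;> omega
    | succ j ih =>
      intro hj x hx
      have hj' : j < n := by omega
      have ih1 := ih hj' (q j) (hq j hj')
      have ih2 := ih hj' (q j + r) (by
        rw [← row j hj']; simp)
      have hrow : q j + s - (j + 1) • s ∈ AddSubgroup.zmultiples r := by
        have e : q j + s - (j + 1) • s = q j - j • s := by rw [succ_nsmul]; abel
        rw [e]; exact hq j hj'
      have hc : ∀ x, x - q (j + 1) ∈ AddSubgroup.zmultiples r → R (q (j + 1)) x := by
        intro x hx
        refine coset_related_of_one_cut hR (q (j + 1)) (fun y hy hne => ?_) hx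
        -- Row `j + 1` also lacks its edge at `q j + s`, but that edge is bypassed through row `j`
        -- by the two columns of the switch. Only the cut at `q (j + 1)` remains.
        by_cases hys : y = q j + s
        · rw [hys]
          have e : q j + s + r = q j + r + s := by abel
          rw [e]
          exact hR.trans (hR.symm (h2 j hj)) (hR.trans (hR.symm ih1) (hR.trans ih2 (h3 j hj)))
        · rw [row _ hj] at hy
          refine h1 y fun i hi => ⟨?_, ?_⟩
          · rintro rfl
            rw [row_unique hn (by omega) hj (hq i (by omega)) hy] at hne
            exact hne rfl
          · rintro rfl
            rcases row_shift_unique hn (by omega) hj (hq i (by omega)) hy with h | h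
            · have : i = j := by omega
              exact hys (by rw [this])
            · omega
      exact hR.trans ih1 (hR.trans (h2 j hj) (hR.trans (hR.symm (hc _ ((row _ hj _).2 hrow)))
        (hc _ ((row _ hj _).2 hx))))
  have all : ∀ x, R (q 0) x := fun x => by
    obtain ⟨j, hj, hx⟩ := hgen x
    exact key j hj x hx
  exact hR.trans (hR.symm (all x)) (all y)

/-- An odd number of rows (cosets of `⟨r⟩`) joined cyclically by one switch between
consecutive rows. -/
lemma chain_cyclic [Finite A] (hR : Equivalence R) (hodd : Odd n)
    (hn : ∀ k : ℤ, k • s ∈ AddSubgroup.zmultiples r ↔ (n : ℤ) ∣ k)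
    (hgen : ∀ x : A, ∃ j < n, x - j • s ∈ AddSubgroup.zmultiples r)
    (hq : ∀ j < n, q j - j • s ∈ AddSubgroup.zmultiples r)
    (h1 : ∀ x, (∀ j, j < n → x ≠ q j ∧ x ≠ q j + s) → R x (x + r))
    (h2 : ∀ j, j < n → R (q j) (q j + s))
    (h3 : ∀ j, j < n → R (q j + r) (q j + r + s)) (x y : A) : R x y := by
  have npos : 0 < n := hodd.pos
  -- In row `j` the edge at `p j` is cut by the switch from the previous row, and the edge at `q j`
  -- by the switch to the next one. Row `0` follows row `n - 1`.
  obtain ⟨p, hp0, hps⟩ : ∃ p : ℕ → A, p 0 = q (n - 1) + s ∧ ∀ j, p (j + 1) = q j + s :=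
    ⟨fun j => Nat.casesOn j (q (n - 1) + s) (fun j => q j + s), rfl, fun _ => rfl⟩
  have hprow : ∀ j < n, p j - j • s ∈ AddSubgroup.zmultiples r := by
    intro j hj
    rcases j with _ | j
    · have h := hq (n - 1) (by omega)
      have h1 : ((n : ℕ) : ℤ) • s ∈ AddSubgroup.zmultiples r := by rw [hn]
      have e : p 0 - 0 • s = q (n - 1) - (n - 1) • s + (n : ℤ) • s := by
        obtain ⟨m, rfl⟩ : ∃ m, n = m + 1 := ⟨n - 1, by omega⟩
        rw [hp0, natCast_zsmul, succ_nsmul, zero_nsmul, Nat.add_sub_cancel]; abel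
      rw [e]; exact add_mem h h1
    · rw [hps, succ_nsmul]
      have := hq j (by omega)
      rwa [show q j + s - (j • s + s) = q j - j • s by abel]
  have row : ∀ j < n, ∀ y, y - j • s ∈ AddSubgroup.zmultiples r →
      ∀ x, x - y ∈ AddSubgroup.zmultiples r ↔ x - j • s ∈ AddSubgroup.zmultiples r :=
    fun j hj y hy x => by
    have e : x - j • s = x - y + (y - j • s) := by abel
    rw [e, AddSubgroup.add_mem_cancel_right _ hy]
  have step : ∀ j < n, ∀ x, x - j • s ∈ AddSubgroup.zmultiples r → x ≠ p j → x ≠ q j →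
      R x (x + r) := by
    intro j hj x hx hxp hxq
    refine h1 x fun i hi => ⟨?_, ?_⟩
    · rintro rfl
      exact hxq (by rw [row_unique hn hi hj (hq i hi) hx])
    · rintro rfl
      rcases row_shift_unique hn hi hj (hq i hi) hx with h | ⟨h, rfl⟩
      · subst h; exact hxp (hps i).symm
      · apply hxp; rw [hp0, show n - 1 = i by omega]
  -- The two arcs of row `j` are named by their last vertices: one runs from `p j + r` to `q j`, the
  -- other from `q j + r` to `p j`.
  have hA : ∀ j < n, R (p j + r) (q j) := fun j hj =>
    coset_related_of_two_cuts hR (p j) (q j) ((row j hj _ (hprow j hj) _).2 (hq j hj))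
      (fun x hx => step j hj x ((row j hj _ (hprow j hj) _).1 hx))
  have hB : ∀ j < n, R (q j + r) (p j) := fun j hj =>
    coset_related_of_two_cuts hR (q j) (p j) ((row j hj _ (hq j hj) _).2 (hprow j hj))
      (fun x hx h h' => step j hj x ((row j hj _ (hq j hj) _).1 hx) h' h)
  have hor : ∀ j < n, ∀ x, x - j • s ∈ AddSubgroup.zmultiples r → R (q j) x ∨ R (p j) x := by
    intro j hj x hx
    rcases coset_related_or_of_two_cuts hR (p j) (q j)
      (fun x hx => step j hj x ((row j hj _ (hprow j hj) _).1 hx))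
      ((row j hj _ (hprow j hj) _).2 hx) with h | h
    · exact .inl (hR.trans (hR.symm (hA j hj)) h)
    · exact .inr (hR.trans (hR.symm (hB j hj)) h)
  -- Each switch joins the `q` arc to the next `p` arc and the `p` arc to the next `q` arc, so the
  -- labels alternate.
  have up1 : ∀ j, j + 1 < n → R (q j) (p (j + 1)) := fun j hj => by
    rw [hps]; exact h2 j (by omega)
  have up2 : ∀ j, j + 1 < n → R (p j) (q (j + 1)) := fun j hj => by
    refine hR.trans (hR.symm (hB j (by omega))) (hR.trans (h3 j (by omega)) ?_)
    have := hA (j + 1) hj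
    rwa [hps, show q j + s + r = q j + r + s by abel] at this
  have par : ∀ k, (2 * k < n → R (q 0) (q (2 * k)) ∧ R (p 0) (p (2 * k))) ∧
      (2 * k + 1 < n → R (q 0) (p (2 * k + 1)) ∧ R (p 0) (q (2 * k + 1))) := by
    intro k
    induction k with
    | zero =>
      exact ⟨fun _ => ⟨hR.refl _, hR.refl _⟩, fun h => ⟨up1 0 h, up2 0 h⟩⟩
    | succ k ih =>
      have a1 : 2 * (k + 1) < n → R (q 0) (q (2 * (k + 1))) ∧ R (p 0) (p (2 * (k + 1))) := by
        intro h
        obtain ⟨i1, i2⟩ := ih.2 (by omega)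
        exact ⟨hR.trans i1 (up2 (2 * k + 1) h), hR.trans i2 (up1 (2 * k + 1) h)⟩
      refine ⟨a1, fun h => ?_⟩
      obtain ⟨i1, i2⟩ := a1 (by omega)
      exact ⟨hR.trans i1 (up1 _ h), hR.trans i2 (up2 _ h)⟩
  -- After one trip around an odd number of rows the labels are interchanged, which merges the two
  -- classes of arcs.
  have h0 : R (q 0) (p 0) := by
    obtain ⟨k, hk⟩ := hodd
    have h := ((par k).1 (by omega)).1
    have h' := h2 (n - 1) (by omega)
    rw [← hp0, show n - 1 = 2 * k by omega] at h'
    exact hR.trans h h'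
  have allpq : ∀ j < n, R (q 0) (q j) ∧ R (q 0) (p j) := by
    intro j hj
    rcases Nat.even_or_odd' j with ⟨k, rfl | rfl⟩
    · obtain ⟨a, b⟩ := (par k).1 hj
      exact ⟨a, hR.trans h0 b⟩
    · obtain ⟨a, b⟩ := (par k).2 hj
      exact ⟨hR.trans h0 b, a⟩
  have all : ∀ x, R (q 0) x := fun x => by
    obtain ⟨j, hj, hx⟩ := hgen x
    obtain ⟨a, b⟩ := allpq j hj
    rcases hor j hj x hx with h | h
    · exact hR.trans a h
    · exact hR.trans b h
  exact hR.trans (hR.symm (all x)) (all y)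

end Chain

/-! ### Switching along squares of a grid -/

/-- A connected `2`-regular graph, that is, a Hamilton cycle regarded as a spanning subgraph. -/
def SimpleGraph.IsSpanningCycle {V : Type*} (H : SimpleGraph V) : Prop :=
  H.Connected ∧ ∀ v, (H.neighborSet v).ncard = 2

/-- The rows `{x, x + r}` and columns `{x, x + s}` form a torus grid. Starting from all row edges,
switch along the squares with lower left corner in `Q`: replace the two row edges of the square by
its two column edges. -/
def switchGraph {A : Type*} [AddCommGroup A] (r s : A) (Q : Set A) : SimpleGraph A :=
  SimpleGraph.fromRel fun x y =>
    (y = x + r ∧ x ∉ Q ∧ x - s ∉ Q) ∨ (y = x + s ∧ (x ∈ Q ∨ x - r ∈ Q))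

section Switch

variable {A : Type*} [AddCommGroup A] {r s : A} {Q : Set A}

lemma switchGraph_adj (hr : r ≠ 0) (hs : s ≠ 0) {x y : A} : (switchGraph r s Q).Adj x y ↔
    (y = x + r ∧ x ∉ Q ∧ x - s ∉ Q) ∨ (y = x - r ∧ x - r ∉ Q ∧ x - r - s ∉ Q) ∨
    (y = x + s ∧ (x ∈ Q ∨ x - r ∈ Q)) ∨ (y = x - s ∧ (x - s ∈ Q ∨ x - r - s ∈ Q)) := by
  have e1 : x = y + r ↔ y = x - r := by rw [eq_sub_iff_add_eq, eq_comm]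
  have e2 : x = y + s ↔ y = x - s := by rw [eq_sub_iff_add_eq, eq_comm]
  rw [switchGraph, SimpleGraph.fromRel_adj, e1, e2]
  constructor
  · rintro ⟨-, (h | h) | ⟨rfl, h⟩ | ⟨rfl, h⟩⟩
    · exact .inl h
    · exact .inr (.inr (.inl h))
    · exact .inr (.inl ⟨rfl, h⟩)
    · refine .inr (.inr (.inr ⟨rfl, ?_⟩))
      rwa [sub_right_comm x r s]
  · rintro (⟨rfl, h⟩ | ⟨rfl, h⟩ | ⟨rfl, h⟩ | ⟨rfl, h⟩)
    · exact ⟨by simpa using hr, .inl (.inl ⟨rfl, h⟩)⟩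
    · exact ⟨by simpa [eq_comm (a := x)] using hr, .inr (.inl ⟨rfl, h⟩)⟩
    · exact ⟨by simpa using hs, .inl (.inr ⟨rfl, h⟩)⟩
    · refine ⟨by simpa [eq_comm (a := x)] using hs, .inr (.inr ⟨rfl, ?_⟩)⟩
      rwa [sub_right_comm x s r]

/-- No two squares of `Q` share a side, so a vertex is a corner of at most two of them, and then of
opposite ones. Each square at the vertex trades one row edge there for one column edge. -/
lemma switchGraph_ncard (hr : r + r ≠ 0) (hs : s + s ≠ 0) (hrs : r ≠ s) (hrs' : r + s ≠ 0)
    (hQr : ∀ x ∈ Q, x + r ∉ Q) (hQs : ∀ x ∈ Q, x + s ∉ Q) (x : A) :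
    ((switchGraph r s Q).neighborSet x).ncard = 2 := by
  have hr0 : r ≠ 0 := by rintro rfl; simp at hr
  have hs0 : s ≠ 0 := by rintro rfl; simp at hs
  have a1 : x - r ∈ Q → x ∉ Q := fun h => by simpa using hQr _ h
  have a2 : x - s ∈ Q → x ∉ Q := fun h => by simpa using hQs _ h
  have a3 : x - r - s ∈ Q → x - r ∉ Q := fun h => by simpa using hQs _ h
  have a4 : x - r - s ∈ Q → x - s ∉ Q := fun h => by
    have := hQr _ h
    rwa [show x - r - s + r = x - s by abel] at this
  have key : ∀ u v : A, u ≠ v → (∀ y, (switchGraph r s Q).Adj x y ↔ y = u ∨ y = v) →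
      ((switchGraph r s Q).neighborSet x).ncard = 2 := by
    intro u v huv h
    rw [← Set.ncard_pair huv]
    congr 1
    ext y
    simp [h]
  have n1 : x + r ≠ x - r := fun h => hr (by
    rw [← sub_eq_zero] at h; rw [← h]; abel)
  have n2 : x + s ≠ x - s := fun h => hs (by
    rw [← sub_eq_zero] at h; rw [← h]; abel)
  have n3 : x + r ≠ x + s := fun h => hrs (by simpa using h)
  have n4 : x - r ≠ x - s := fun h => hrs (by simpa using h)
  have n5 : x + r ≠ x - s := fun h => hrs' (by
    rw [← sub_eq_zero] at h; rw [← h]; abel)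
  have n6 : x - r ≠ x + s := fun h => hrs' (by
    rw [eq_comm, ← sub_eq_zero] at h; rw [← h]; abel)
  simp only [switchGraph_adj hr0 hs0] at key
  by_cases b1 : x ∈ Q <;> by_cases b2 : x - r ∈ Q <;> by_cases b3 : x - s ∈ Q <;>
    by_cases b4 : x - r - s ∈ Q <;> simp only [b1, b2, b3, b4, not_true_eq_false, not_false_eq_true,
      and_true, and_false, or_true, false_or, or_false, or_self, and_self] at key a1 a2 a3 a4
  all_goals first
    | with_reducible exact key _ _ n1 fun _ => Iff.rfl
    | with_reducible exact key _ _ n2 fun _ => Iff.rfl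
    | with_reducible exact key _ _ n3 fun _ => Iff.rfl
    | with_reducible exact key _ _ n4 fun _ => Iff.rfl
    | with_reducible exact key _ _ n5 fun _ => Iff.rfl
    | with_reducible exact key _ _ n6 fun _ => Iff.rfl
    | (exfalso; simp_all)

/-- Exchanging `r` and `s` negates the condition on every edge. The hypotheses make the four
neighbours of a vertex distinct, so no edge is of two kinds at once. -/
lemma switchGraph_disjoint (hr : r + r ≠ 0) (hs : s + s ≠ 0) (hrs : r ≠ s) (hrs' : r + s ≠ 0) :
    Disjoint (switchGraph r s Q) (switchGraph s r Q) := by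
  have hr0 : r ≠ 0 := by rintro rfl; simp at hr
  have hs0 : s ≠ 0 := by rintro rfl; simp at hs
  rw [SimpleGraph.disjoint_left]
  intro x y h1 h2
  have n1 : x + r ≠ x - r := fun h => hr (by
    rw [← sub_eq_zero] at h; rw [← h]; abel)
  have n2 : x + s ≠ x - s := fun h => hs (by
    rw [← sub_eq_zero] at h; rw [← h]; abel)
  have n3 : x + r ≠ x + s := fun h => hrs (by simpa using h)
  have n4 : x - r ≠ x - s := fun h => hrs (by simpa using h)
  have n5 : x + r ≠ x - s := fun h => hrs' (by
    rw [← sub_eq_zero] at h; rw [← h]; abel)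
  have n6 : x - r ≠ x + s := fun h => hrs' (by
    rw [eq_comm, ← sub_eq_zero] at h; rw [← h]; abel)
  rw [switchGraph_adj hr0 hs0] at h1
  rw [switchGraph_adj hs0 hr0, sub_right_comm x s r] at h2
  rcases h1 with ⟨e, h1⟩ | ⟨e, h1⟩ | ⟨e, h1⟩ | ⟨e, h1⟩ <;>
    rcases h2 with ⟨f, h2⟩ | ⟨f, h2⟩ | ⟨f, h2⟩ | ⟨f, h2⟩ <;> rw [e] at f <;> clear e
  all_goals first
    | with_reducible exact absurd f n1
    | with_reducible exact absurd f n2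
    | with_reducible exact absurd f n3
    | with_reducible exact absurd f n4
    | with_reducible exact absurd f n5
    | with_reducible exact absurd f n6
    | with_reducible exact absurd f.symm n1
    | with_reducible exact absurd f.symm n2
    | with_reducible exact absurd f.symm n3
    | with_reducible exact absurd f.symm n4
    | with_reducible exact absurd f.symm n5
    | with_reducible exact absurd f.symm n6
    | exact h1.elim (fun h => h2.1 h) (fun h => h2.2 h)
    | exact h2.elim (fun h => h1.1 h) (fun h => h1.2 h)

lemma switchGraph_sup (hr : r ≠ 0) (hs : s ≠ 0) (x y : A) :
    (switchGraph r s Q ⊔ switchGraph s r Q).Adj x y ↔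
      (y = x + r ∨ y = x - r) ∨ (y = x + s ∨ y = x - s) := by
  rw [SimpleGraph.sup_adj, switchGraph_adj hr hs, switchGraph_adj hs hr, sub_right_comm x s r]
  generalize (y = x + r) = a
  generalize (y = x - r) = b
  generalize (y = x + s) = c
  generalize (y = x - s) = d
  by_cases h1 : x ∈ Q <;> by_cases h2 : x - r ∈ Q <;> by_cases h3 : x - s ∈ Q <;>
    by_cases h4 : x - r - s ∈ Q <;> simp only [h1, h2, h3, h4, not_true_eq_false,
      not_false_eq_true, and_true, and_false, or_true, false_or, or_false, or_self] <;>
    clear * - <;> grind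

lemma switchGraph_adj_row (hr : r ≠ 0) {x : A} (h : x ∉ Q) (h' : x - s ∉ Q) :
    (switchGraph r s Q).Adj x (x + r) := by
  rw [switchGraph, SimpleGraph.fromRel_adj]
  exact ⟨by simpa using hr, .inl (.inl ⟨rfl, h, h'⟩)⟩

lemma switchGraph_adj_col (hs : s ≠ 0) {x : A} (h : x ∈ Q ∨ x - r ∈ Q) :
    (switchGraph r s Q).Adj x (x + s) := by
  rw [switchGraph, SimpleGraph.fromRel_adj]
  exact ⟨by simpa using hs, .inl (.inr ⟨rfl, h⟩)⟩

end Switch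

/-! ### The torus grid and its switch set -/

lemma exists_index {A : Type*} [AddCommGroup A] [Finite A] {r s : A}
    (hgen : ∀ x : A, ∃ i j : ℤ, x = i • r + j • s) :
    ∃ n : ℕ, 0 < n ∧ (∀ k : ℤ, k • s ∈ AddSubgroup.zmultiples r ↔ (n : ℤ) ∣ k) ∧
      ∀ x : A, ∃ j < n, x - j • s ∈ AddSubgroup.zmultiples r := by
  have hn : ∀ k : ℤ, k • s ∈ AddSubgroup.zmultiples r ↔
      (addOrderOf (s : A ⧸ AddSubgroup.zmultiples r) : ℤ) ∣ k := by
    intro k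
    rw [addOrderOf_dvd_iff_zsmul_eq_zero, ← QuotientAddGroup.eq_zero_iff]
    rfl
  have hpos := addOrderOf_pos (s : A ⧸ AddSubgroup.zmultiples r)
  refine ⟨_, hpos, hn, fun x => ?_⟩
  generalize addOrderOf (s : A ⧸ AddSubgroup.zmultiples r) = n at hn hpos
  obtain ⟨i, j, rfl⟩ := hgen x
  refine ⟨(j % n).toNat, ?_, ?_⟩
  · have := Int.emod_lt_of_pos j (b := n) (by omega)
    have := Int.emod_nonneg j (b := n) (by omega)
    omega
  · rw [← natCast_zsmul, Int.toNat_of_nonneg (Int.emod_nonneg j (by omega)), add_sub_assoc,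
      ← sub_smul]
    refine add_mem (zsmul_mem (AddSubgroup.mem_zmultiples r) i) ((hn _).2 ?_)
    exact Int.dvd_self_sub_emod

/-- Generators `r`, `s` whose rows (cosets of `⟨r⟩`) are indexed by `j < n` and whose columns
(cosets of `⟨s⟩`) are indexed by `i < d`. -/
structure TorusGrid {A : Type*} [AddCommGroup A] (r s : A) (n d : ℕ) : Prop where
  two_r : r + r ≠ 0
  two_s : s + s ≠ 0
  ne : r ≠ s
  add_ne : r + s ≠ 0
  row : ∀ k : ℤ, k • s ∈ AddSubgroup.zmultiples r ↔ (n : ℤ) ∣ k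
  row_gen : ∀ x : A, ∃ j < n, x - j • s ∈ AddSubgroup.zmultiples r
  col : ∀ k : ℤ, k • r ∈ AddSubgroup.zmultiples s ↔ (d : ℤ) ∣ k
  col_gen : ∀ x : A, ∃ j < d, x - j • r ∈ AddSubgroup.zmultiples s

/-- The column of the square switched between the rows `j` and `j + 1`. -/
def switchCol (c j : ℕ) : ℕ := if j ≤ c then j else c + j % 2

/-- The lower left corners of the switched squares. -/
def switchSet {A : Type*} [AddCommGroup A] (r s : A) (c L : ℕ) : Set A :=
  {x | ∃ j ≤ L, x = switchCol c j • r + j • s}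

lemma switchCol_of_le {c j : ℕ} (h : j ≤ c) : switchCol c j = j := if_pos h

lemma switchCol_even {c j : ℕ} (hc : c ≤ j) (he : Even c) (hj : Even j) : switchCol c j = c := by
  unfold switchCol
  rw [Nat.even_iff] at *
  split_ifs <;> omega

lemma switchCol_odd {c j : ℕ} (hc : c ≤ j) (he : Even c) (hj : Odd j) :
    switchCol c j = c + 1 := by
  unfold switchCol
  rw [Nat.even_iff] at *
  rw [Nat.odd_iff] at *
  split_ifs <;> omega

/-- Consecutive switched squares lie in adjacent columns, so they meet in a corner and need not
share a side. -/
lemma switchCol_succ {c : ℕ} (he : Even c) (j : ℕ) :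
    switchCol c (j + 1) = switchCol c j + 1 ∨ switchCol c j = switchCol c (j + 1) + 1 := by
  unfold switchCol
  rw [Nat.even_iff] at *
  split_ifs <;> omega

namespace TorusGrid

variable {A : Type*} [AddCommGroup A] {r s : A} {n d c L : ℕ}

lemma swap (G : TorusGrid r s n d) : TorusGrid s r d n :=
  ⟨G.two_s, G.two_r, G.ne.symm, by rw [add_comm]; exact G.add_ne, G.col, G.col_gen, G.row,
    G.row_gen⟩

lemma r_ne (G : TorusGrid r s n d) : r ≠ 0 := fun h => G.two_r (by rw [h, add_zero])

lemma s_ne (G : TorusGrid r s n d) : s ≠ 0 := G.swap.r_ne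

lemma mem_row (k j : ℕ) : k • r + j • s - j • s ∈ AddSubgroup.zmultiples r := by
  rw [add_sub_cancel_right]
  exact nsmul_mem (AddSubgroup.mem_zmultiples r) k

lemma mem_col (k j : ℕ) : k • r + j • s - k • r ∈ AddSubgroup.zmultiples s := by
  rw [add_sub_cancel_left]
  exact nsmul_mem (AddSubgroup.mem_zmultiples s) j

lemma row_eq (G : TorusGrid r s n d) {k j k' j' : ℕ} (hj : j < n) (hj' : j' < n)
    (h : k • r + j • s = k' • r + j' • s) : j = j' :=
  row_unique G.row hj hj' (mem_row k j) (h ▸ mem_row k' j')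

lemma grid_succ_ne (G : TorusGrid r s n d) {k j j' : ℕ} (hj : j < n) (hj' : j' < n) :
    k • r + j • s ≠ (k + 1) • r + j' • s := by
  intro h
  have e := G.row_eq hj hj' h
  subst e
  rw [succ_nsmul] at h
  exact G.r_ne (by simpa using h)

lemma grid_add_two_ne (G : TorusGrid r s n d) {k j j' : ℕ} (hj : j < n) (hj' : j' < n) :
    k • r + j • s ≠ (k + 2) • r + j' • s := by
  intro h
  have e := G.row_eq hj hj' h
  subst e
  rw [add_nsmul, two_nsmul] at h
  exact G.two_r (by simpa using h)

/-- This keeps the last switched square from lying directly below the first one when the rows close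
up. Otherwise `d` divides `c < d`, so `c = 0` and `n • s = 0`. Since `d ≤ 2`, the element `2 • r` is
a multiple of `s`, hence a multiple of `n • s`, contradicting `two_r`. -/
lemma wrap_ne (G : TorusGrid r s n d) (hcd : c < d) (hd : d ≤ c + 2) : c • r + n • s ≠ 0 := by
  intro h
  have hc : (d : ℤ) ∣ (c : ℤ) := by
    rw [← G.col, natCast_zsmul, eq_neg_of_add_eq_zero_left h]
    exact neg_mem (nsmul_mem (AddSubgroup.mem_zmultiples s) n)
  have hc0 : c = 0 := Nat.eq_zero_of_dvd_of_lt (by exact_mod_cast hc) hcd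
  subst hc0
  rw [zero_nsmul, zero_add] at h
  have h2 : (2 : ℕ) • r ∈ AddSubgroup.zmultiples s ∧ (d : ℤ) • r ∈ AddSubgroup.zmultiples s := by
    have : (d : ℤ) ∣ 2 := by
      rcases (by omega : d = 1 ∨ d = 2) with rfl | rfl <;> norm_num
    have h2 := (G.col 2).2 this
    exact ⟨by rwa [← natCast_zsmul], (G.col d).2 dvd_rfl⟩
  obtain ⟨t, ht⟩ := AddSubgroup.mem_zmultiples_iff.1 h2.1
  have hnt : (n : ℤ) ∣ t := by
    rw [← G.row, ht]
    exact nsmul_mem (AddSubgroup.mem_zmultiples r) 2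
  obtain ⟨u, rfl⟩ := hnt
  rw [mul_comm, mul_smul, natCast_zsmul, h, smul_zero, two_nsmul] at ht
  exact G.two_r ht.symm

lemma switchSet_add_r (G : TorusGrid r s n d) (hL : L < n) :
    ∀ x ∈ switchSet r s c L, x + r ∉ switchSet r s c L := by
  rintro x ⟨j, hj, rfl⟩ ⟨i, hi, h⟩
  have e : switchCol c j • r + j • s + r = (switchCol c j + 1) • r + j • s := by
    rw [succ_nsmul]; abel
  rw [e] at h
  have := G.row_eq (by omega) (by omega) h
  subst this
  exact G.grid_succ_ne (k := switchCol c j) (by omega) (by omega) h.symm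

lemma switchSet_add_s (G : TorusGrid r s n d) (hL : L < n) (hc : Even c) (hLe : Even L)
    (hcL : c ≤ L) (hcd : c < d) (hd : d ≤ c + 2) :
    ∀ x ∈ switchSet r s c L, x + s ∉ switchSet r s c L := by
  rintro x ⟨j, hj, rfl⟩ ⟨i, hi, h⟩
  rcases row_shift_unique G.row (by omega) (by omega) (mem_row (switchCol c j) j)
    (h ▸ mem_row (switchCol c i) i) with hji | ⟨hji, rfl⟩
  · subst hji
    have e : switchCol c j • r + j • s + s = switchCol c j • r + (j + 1) • s := by
      rw [succ_nsmul]; abel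
    rw [e] at h
    rcases switchCol_succ hc j with h' | h' <;> rw [h'] at h
    · exact G.grid_succ_ne (by omega) (by omega) h
    · exact G.grid_succ_ne (by omega) (by omega) h.symm
  · have hjL : j = L := by omega
    subst hjL
    rw [switchCol_even hcL hc hLe, switchCol_of_le (Nat.zero_le c), zero_nsmul, zero_nsmul,
      add_assoc, ← succ_nsmul, hji, add_zero] at h
    exact G.wrap_ne hcd hd h

/-- There is one switch from each row `j ≤ L` to the next, in whatever column. For `L + 2 = n` the
rows form a path, and for odd `n = L + 1` an odd cycle. -/
lemma row_connected [Finite A] (G : TorusGrid r s n d)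
    (hLn : Odd n ∧ L + 1 = n ∨ L + 2 = n) (x y : A) :
    (switchGraph r s (switchSet r s c L)).Reachable x y := by
  have hR : Equivalence (switchGraph r s (switchSet r s c L)).Reachable :=
    SimpleGraph.reachable_is_equivalence _
  have h1 : ∀ x, (∀ j ≤ L, x ≠ switchCol c j • r + j • s ∧ x ≠ switchCol c j • r + j • s + s) →
      (switchGraph r s (switchSet r s c L)).Reachable x (x + r) := by
    intro x hx
    refine (switchGraph_adj_row G.r_ne ?_ ?_).reachable
    · rintro ⟨j, hj, h⟩
      exact (hx j hj).1 h
    · rintro ⟨j, hj, h⟩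
      exact (hx j hj).2 (by rw [← h, sub_add_cancel])
  have h2 : ∀ j ≤ L, (switchGraph r s (switchSet r s c L)).Reachable
      (switchCol c j • r + j • s) (switchCol c j • r + j • s + s) := fun j hj =>
    (switchGraph_adj_col (Q := switchSet r s c L) G.s_ne (.inl ⟨j, hj, rfl⟩)).reachable
  have h3 : ∀ j ≤ L, (switchGraph r s (switchSet r s c L)).Reachable
      (switchCol c j • r + j • s + r) (switchCol c j • r + j • s + r + s) := fun j hj =>
    (switchGraph_adj_col (Q := switchSet r s c L) G.s_ne (.inr ⟨j, hj, by rw [add_sub_cancel_right]⟩)).reachable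
  rcases hLn with ⟨hodd, hLn⟩ | hLn
  · exact chain_cyclic (q := fun j => switchCol c j • r + j • s) hR hodd G.row G.row_gen
      (fun j _ => mem_row _ j) (fun x hx => h1 x fun j hj => hx j (by omega))
      (fun j hj => h2 j (by omega)) (fun j hj => h3 j (by omega)) x y
  · exact chain_linear (q := fun j => switchCol c j • r + j • s) hR G.row G.row_gen
      (fun j _ => mem_row _ j) (fun x hx => h1 x fun j hj => hx j (by omega))
      (fun j hj => h2 j (by omega)) (fun j hj => h3 j (by omega)) x y

end TorusGrid

/-! ### Connectivity of the switched columns -/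

namespace TorusGrid

variable {A : Type*} [AddCommGroup A] {r s : A} {n d c L : ℕ}

/-- Columns `a < c` have one switch to the next column, in row `a`. All rows from `c` to `L` switch
alternately at columns `c` and `c + 1`. Identifying the vertices of column `c` in these rows, and
likewise those of column `c + 1`, leaves a single effective switch there, so the chain lemmas apply.
The snake shows that nothing is lost by the identification. -/
lemma col_connected [Finite A] (G : TorusGrid r s n d) (hL : L < n) (hc : Even c) (hLe : Even L)
    (hcL : c ≤ L) (hcd : Odd d ∧ c + 1 = d ∨ c + 2 = d) (x y : A) :
    (switchGraph s r (switchSet r s c L)).Reachable x y := by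
  classical
  set R := (switchGraph s r (switchSet r s c L)).Reachable with hRdef
  have hR : Equivalence R := SimpleGraph.reachable_is_equivalence _
  have succ_eq : ∀ k j : ℕ, k • r + j • s + s = k • r + (j + 1) • s := fun k j => by
    rw [succ_nsmul]; abel
  have succ_eq' : ∀ k j : ℕ, k • r + j • s + r = (k + 1) • r + j • s := fun k j => by
    rw [succ_nsmul]; abel
  have hrow : ∀ j ≤ L, R (switchCol c j • r + j • s) ((switchCol c j + 1) • r + j • s) := by
    intro j hj
    rw [← succ_eq']
    exact (switchGraph_adj_col (Q := switchSet r s c L) G.r_ne (.inl ⟨j, hj, rfl⟩)).reachable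
  have hrow' : ∀ j ≤ L, R (switchCol c j • r + (j + 1) • s)
      ((switchCol c j + 1) • r + (j + 1) • s) := by
    intro j hj
    rw [← succ_eq', ← succ_eq]
    exact (switchGraph_adj_col (Q := switchSet r s c L) G.r_ne
      (.inr ⟨j, hj, by rw [add_sub_cancel_right]⟩)).reachable
  -- In the rows `c < j ≤ L` the columns `c`, `c + 1`, `c + 2` form a snake.
  have snake : ∀ j, c < j → j ≤ L → R (c • r + j • s) ((c + 1) • r + j • s) ∧
      R ((c + 1) • r + j • s) ((c + 2) • r + j • s) := by
    intro j hcj hjL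
    obtain ⟨i, rfl⟩ : ∃ i, j = i + 1 := ⟨j - 1, by omega⟩
    have h1 := hrow (i + 1) hjL
    have h2 := hrow' i (by omega)
    rcases Nat.even_or_odd i with hi | hi
    · rw [switchCol_odd hcj.le hc hi.add_one] at h1
      rw [switchCol_even (by omega) hc hi] at h2
      exact ⟨h2, h1⟩
    · rw [switchCol_even hcj.le hc hi.add_one] at h1
      rw [switchCol_odd (by omega) hc hi] at h2
      exact ⟨h1, h2⟩
  have snake_up : ∀ j, c < j → j < L → Odd j →
      R ((c + 2) • r + j • s) ((c + 2) • r + (j + 1) • s) := by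
    intro j hcj hjL hj
    -- For odd `j` the switch sits at column `c + 1`, so the edge of column `c` survives. It
    -- replaces the missing edge of column `c + 2` by a detour along the snake.
    have up : R (c • r + j • s) (c • r + (j + 1) • s) := by
      rw [← succ_eq]
      refine (switchGraph_adj_row (Q := switchSet r s c L) G.s_ne ?_ ?_).reachable
      · rintro ⟨i, hi, h⟩
        have := G.row_eq (by omega) (by omega) h
        subst this
        rw [switchCol_odd hcj.le hc hj] at h
        exact G.grid_succ_ne (by omega) (by omega) h
      · rintro ⟨i, hi, h⟩
        rw [sub_eq_iff_eq_add, succ_eq'] at h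
        have := G.row_eq (by omega) (by omega) h
        subst this
        rw [switchCol_odd hcj.le hc hj] at h
        exact G.grid_add_two_ne (by omega) (by omega) h
    have a := snake j hcj hjL.le
    have b := snake (j + 1) (by omega) hjL
    exact hR.trans (hR.symm (hR.trans a.1 a.2)) (hR.trans up (hR.trans b.1 b.2))
  -- `φ` collapses the first two columns of the snake.
  let φ : A → A := fun x =>
    if ∃ j, c < j ∧ j ≤ L ∧ x = c • r + j • s then c • r + c • s
    else if ∃ j, c < j ∧ j ≤ L ∧ x = (c + 1) • r + j • s then (c + 1) • r + c • s else x
  have φ_id : ∀ x, (∀ j, c < j → j ≤ L → x ≠ c • r + j • s) →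
      (∀ j, c < j → j ≤ L → x ≠ (c + 1) • r + j • s) → φ x = x := by
    intro x h1 h2
    simp only [φ]
    rw [if_neg (by rintro ⟨j, a, b, e⟩; exact h1 j a b e),
      if_neg (by rintro ⟨j, a, b, e⟩; exact h2 j a b e)]
  have φ_low : ∀ k j : ℕ, j ≤ c → φ (k • r + j • s) = k • r + j • s := by
    intro k j hj
    refine φ_id _ (fun i hi hi' h => ?_) (fun i hi hi' h => ?_) <;>
    · have := G.row_eq (by omega) (by omega) h
      omega
  have φ_top : ∀ k : ℕ, φ (k • r + (L + 1) • s) = k • r + (L + 1) • s := by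
    intro k
    refine φ_id _ (fun i hi hi' h => ?_) (fun i hi hi' h => ?_) <;>
    · rw [← succ_eq] at h
      rcases row_shift_unique G.row hL (by omega) (mem_row k L) (h ▸ mem_row _ i) with h | h <;>
        omega
  have φ_left : ∀ j, c ≤ j → j ≤ L → φ (c • r + j • s) = c • r + c • s := by
    intro j hj hj'
    rcases hj.eq_or_lt with rfl | hj
    · exact φ_low _ _ le_rfl
    · simp only [φ]
      rw [if_pos ⟨j, hj, hj', rfl⟩]
  have φ_right : ∀ j, c ≤ j → j ≤ L → φ ((c + 1) • r + j • s) = (c + 1) • r + c • s := by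
    intro j hj hj'
    rcases hj.eq_or_lt with rfl | hj
    · exact φ_low _ _ le_rfl
    · simp only [φ]
      rw [if_neg, if_pos ⟨j, hj, hj', rfl⟩]
      rintro ⟨i, hi, hi', h⟩
      exact G.grid_succ_ne (by omega) (by omega) h.symm
  -- The chain lemmas hold for any equivalence relation, in particular for reachability pulled back
  -- along `φ`.
  have hR' : Equivalence fun x y => R (φ x) (φ y) := hR.comap φ
  -- The effective switch of column `c` is placed in row `L`, the last row of the identified
  -- segment, where the edges up to row `L + 1` are cut. As `L` is even, that switch is indeed at
  -- column `c`.
  let q : ℕ → A := fun a => a • r + (if a < c then a else L) • s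
  have q_lt : ∀ a, a < c → q a = a • r + a • s := fun a ha => by simp only [q, if_pos ha]
  have q_c : q c = c • r + L • s := by simp only [q, lt_irrefl, if_false]
  have h1 : ∀ x, (∀ a ≤ c, x ≠ q a ∧ x ≠ q a + r) → R (φ x) (φ (x + s)) := by
    intro x hx
    have hxc := hx c le_rfl
    rw [q_c, succ_eq'] at hxc
    have left : ∀ j, c ≤ j → j ≤ L → x = c • r + j • s → R (φ x) (φ (x + s)) := by
      rintro j hj hj' rfl
      rcases hj'.eq_or_lt with rfl | hj'
      · exact absurd rfl hxc.1
      · rw [succ_eq, φ_left j hj hj'.le, φ_left (j + 1) (by omega) hj']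
    have right : ∀ j, c ≤ j → j ≤ L → x = (c + 1) • r + j • s → R (φ x) (φ (x + s)) := by
      rintro j hj hj' rfl
      rcases hj'.eq_or_lt with rfl | hj'
      · exact absurd rfl hxc.2
      · rw [succ_eq, φ_right j hj hj'.le, φ_right (j + 1) (by omega) hj']
    by_cases hl : ∃ j, c ≤ j ∧ j ≤ L ∧ x = c • r + j • s
    · obtain ⟨j, a, b, e⟩ := hl
      exact left j a b e
    by_cases hr : ∃ j, c ≤ j ∧ j ≤ L ∧ x = (c + 1) • r + j • s
    · obtain ⟨j, a, b, e⟩ := hr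
      exact right j a b e
    have φx : φ x = x := φ_id x (fun j a b e => hl ⟨j, a.le, b, e⟩)
      (fun j a b e => hr ⟨j, a.le, b, e⟩)
    have φxs : φ (x + s) = x + s := by
      refine φ_id _ (fun j a b e => hl ?_) (fun j a b e => hr ?_) <;>
      · obtain ⟨i, rfl⟩ : ∃ i, j = i + 1 := ⟨j - 1, by omega⟩
        rw [← succ_eq, add_left_inj] at e
        exact ⟨i, by omega, by omega, e⟩
    rw [φx, φxs]
    by_cases hxQ : x ∈ switchSet r s c L
    · exfalso
      obtain ⟨j, hj, e⟩ := hxQ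
      rcases Nat.lt_or_ge j c with hjc | hjc
      · rw [switchCol_of_le hjc.le, ← q_lt j hjc] at e
        exact (hx j hjc.le).1 e
      · rcases Nat.even_or_odd j with hj2 | hj2
        · rw [switchCol_even hjc hc hj2] at e
          exact hl ⟨j, hjc, hj, e⟩
        · rw [switchCol_odd hjc hc hj2] at e
          exact hr ⟨j, hjc, hj, e⟩
    by_cases hxQ' : x - r ∈ switchSet r s c L
    · obtain ⟨j, hj, e⟩ := hxQ'
      rw [sub_eq_iff_eq_add] at e
      rcases Nat.lt_or_ge j c with hjc | hjc
      · rw [switchCol_of_le hjc.le, ← q_lt j hjc] at e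
        exact absurd e (hx j hjc.le).2
      · rw [succ_eq'] at e
        rcases Nat.even_or_odd j with hj2 | hj2
        · rw [switchCol_even hjc hc hj2] at e
          exact absurd ⟨j, hjc, hj, e⟩ hr
        · rw [switchCol_odd hjc hc hj2] at e
          rw [e, succ_eq]
          rw [Nat.even_iff] at hc hLe
          have hj3 := Nat.odd_iff.1 hj2
          exact snake_up j (by omega) (by omega) hj2
    · exact (switchGraph_adj_row (Q := switchSet r s c L) G.s_ne hxQ hxQ').reachable
  have h2 : ∀ a ≤ c, R (φ (q a)) (φ (q a + r)) := by
    intro a ha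
    rcases ha.eq_or_lt with rfl | ha
    · rw [q_c, succ_eq', φ_left L hcL le_rfl, φ_right L hcL le_rfl]
      have := hrow a hcL
      rwa [switchCol_of_le le_rfl] at this
    · rw [q_lt a ha, succ_eq', φ_low _ _ ha.le, φ_low _ _ ha.le]
      have := hrow a (by omega)
      rwa [switchCol_of_le ha.le] at this
  have h3 : ∀ a ≤ c, R (φ (q a + s)) (φ (q a + s + r)) := by
    intro a ha
    rcases ha.eq_or_lt with rfl | ha
    · rw [q_c, succ_eq, succ_eq', φ_top, φ_top]
      have := hrow' L le_rfl
      rwa [switchCol_even hcL hc hLe] at this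
    · rw [q_lt a ha, succ_eq, succ_eq', φ_low _ _ ha, φ_low _ _ ha]
      have := hrow' a (by omega)
      rwa [switchCol_of_le ha.le] at this
  have all : ∀ x y, R (φ x) (φ y) := by
    rcases hcd with ⟨hodd, hcd⟩ | hcd
    · exact chain_cyclic hR' hodd G.col G.col_gen (fun j _ => mem_col j _)
        (fun x hx => h1 x fun a ha => hx a (by omega)) (fun a ha => h2 a (by omega))
        (fun a ha => h3 a (by omega))
    · exact chain_linear hR' G.col G.col_gen (fun j _ => mem_col j _)
        (fun x hx => h1 x fun a ha => hx a (by omega)) (fun a ha => h2 a (by omega))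
        (fun a ha => h3 a (by omega))
  have φ_snake : ∀ j, c < j → j ≤ L → φ ((c + 2) • r + j • s) = (c + 2) • r + j • s :=
    fun j _ hj => φ_id _
      (fun i _ hi h => G.grid_add_two_ne (by omega) (by omega) h.symm)
      (fun i _ hi h => G.grid_succ_ne (by omega) (by omega) h.symm)
  -- Every identified vertex is joined by the snake to column `c + 2`, which `φ` fixes there, so
  -- connectivity modulo `φ` gives true connectivity.
  have fixed : ∀ x, ∃ y, R x y ∧ φ y = y := by
    intro x
    by_cases hl : ∃ j, c < j ∧ j ≤ L ∧ x = c • r + j • s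
    · obtain ⟨j, a, b, rfl⟩ := hl
      exact ⟨_, hR.trans (snake j a b).1 (snake j a b).2, φ_snake j a b⟩
    by_cases hr : ∃ j, c < j ∧ j ≤ L ∧ x = (c + 1) • r + j • s
    · obtain ⟨j, a, b, rfl⟩ := hr
      exact ⟨_, (snake j a b).2, φ_snake j a b⟩
    exact ⟨x, hR.refl x, φ_id x (fun j a b e => hl ⟨j, a, b, e⟩) fun j a b e => hr ⟨j, a, b, e⟩⟩
  obtain ⟨x', hx, hx'⟩ := fixed x
  obtain ⟨y', hy, hy'⟩ := fixed y
  have h := all x' y'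
  rw [hx', hy'] at h
  exact hR.trans hx (hR.trans h (hR.symm hy))

lemma exists_decomposition [Finite A] (G : TorusGrid r s n d) (hdn : d ≤ n) (hd : 0 < d) :
    ∃ H₁ H₂ : SimpleGraph A, H₁.IsSpanningCycle ∧ H₂.IsSpanningCycle ∧ Disjoint H₁ H₂ ∧
      ∀ x y, (H₁ ⊔ H₂).Adj x y ↔ (y = x + r ∨ y = x - r) ∨ (y = x + s ∨ y = x - s) := by
  have : Nonempty A := ⟨0⟩
  -- The largest even number below `m` serves as `L` for `m = n` and as `c` for `m = d`. Then `d ≤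
  -- n` gives `c ≤ L`.
  have parity : ∀ m : ℕ, 0 < m → ∃ k, Even k ∧ k < m ∧ (Odd m ∧ k + 1 = m ∨ k + 2 = m) := by
    intro m hm
    rcases Nat.even_or_odd' m with ⟨k, rfl | rfl⟩
    · exact ⟨2 * (k - 1), even_two_mul _, by omega, .inr (by omega)⟩
    · exact ⟨2 * k, even_two_mul _, by omega, .inl ⟨odd_two_mul_add_one k, rfl⟩⟩
  obtain ⟨L, hLe, hLn, hL⟩ := parity n (by omega)
  obtain ⟨c, hc, hcd, hc'⟩ := parity d hd
  have hcL : c ≤ L := by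
    rw [Nat.even_iff] at hLe hc
    omega
  have hQr := G.switchSet_add_r (c := c) hLn
  have hQs := G.switchSet_add_s hLn hc hLe hcL hcd (by omega)
  refine ⟨switchGraph r s (switchSet r s c L), switchGraph s r (switchSet r s c L),
    ⟨⟨G.row_connected hL⟩, switchGraph_ncard G.two_r G.two_s G.ne G.add_ne hQr hQs⟩,
    ⟨⟨G.col_connected hLn hc hLe hcL hc'⟩,
      switchGraph_ncard G.two_s G.two_r G.swap.ne G.swap.add_ne hQs hQr⟩,
    switchGraph_disjoint G.two_r G.two_s G.ne G.add_ne, switchGraph_sup G.r_ne G.s_ne⟩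

end TorusGrid

/-- The Cayley graph of a finite abelian group with connection set `{r, -r, s, -s}`, where `r` and
`s` generate the group and `r`, `-r`, `s`, `-s` are distinct, decomposes into two Hamilton
cycles. -/
lemma exists_decomposition_of_two_generators {A : Type*} [AddCommGroup A] [Finite A] {r s : A}
    (hgen : ∀ x : A, ∃ i j : ℤ, x = i • r + j • s) (hr : r + r ≠ 0) (hs : s + s ≠ 0)
    (hrs : r ≠ s) (hrs' : r + s ≠ 0) :
    ∃ H₁ H₂ : SimpleGraph A, H₁.IsSpanningCycle ∧ H₂.IsSpanningCycle ∧ Disjoint H₁ H₂ ∧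
      ∀ x y, (H₁ ⊔ H₂).Adj x y ↔ (y = x + r ∨ y = x - r) ∨ (y = x + s ∨ y = x - s) := by
  obtain ⟨n, hn, row, row_gen⟩ := exists_index hgen
  obtain ⟨d, hd, col, col_gen⟩ := exists_index (r := s) (s := r) fun x => by
    obtain ⟨i, j, h⟩ := hgen x
    exact ⟨j, i, by rw [h, add_comm]⟩
  have G : TorusGrid r s n d := ⟨hr, hs, hrs, hrs', row, row_gen, col, col_gen⟩
  rcases le_total d n with h | h
  · exact G.exists_decomposition h hd
  · obtain ⟨H₁, H₂, h1, h2, h3, h4⟩ := G.swap.exists_decomposition h hn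
    exact ⟨H₁, H₂, h1, h2, h3, fun x y => (h4 x y).trans or_comm⟩

/-! ### Spanning cycles and Hamilton cycles -/

namespace SimpleGraph

variable {V W : Type*}

namespace IsSpanningCycle

variable {H : SimpleGraph V}

lemma isCycles (h : H.IsSpanningCycle) : H.IsCycles := fun v _ => h.2 v

lemma connected_deleteEdges [Finite V] (h : H.IsSpanningCycle) {u v : V} (huv : H.Adj u v) :
    (H.deleteEdges {s(u, v)}).Connected := by
  refine h.1.connected_delete_edge_of_not_isBridge fun hb => ?_
  exact isBridge_iff.1 hb (h.isCycles.reachable_deleteEdges huv)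

/-- In a `2`-regular graph a cycle fills its component, which is everything here, and it uses both
edges at each of its vertices. -/
lemma exists_isHamiltonianCycle [Finite V] [DecidableEq V] (h : H.IsSpanningCycle) :
    ∃ (v : V) (p : H.Walk v v), p.IsHamiltonianCycle ∧ p.edgeSet = H.edgeSet := by
  obtain ⟨v⟩ := h.1.nonempty
  have hne : (H.neighborSet v).Nonempty := Set.nonempty_of_ncard_ne_zero (by rw [h.2 v]; norm_num)
  obtain ⟨p, hp, hverts⟩ := h.isCycles.exists_cycle_toSubgraph_verts_eq_connectedComponentSupp
    (c := H.connectedComponentMk v) rfl hne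
  have hall : ∀ x, x ∈ p.support := fun x => by
    rw [← p.mem_verts_toSubgraph, hverts]
    exact ConnectedComponent.sound (h.1.preconnected x v)
  refine ⟨v, p, ⟨hp, hp.isPath_tail.isHamiltonian_of_mem fun x => ?_⟩, ?_⟩
  · rw [p.support_tail_of_not_nil hp.not_nil]
    by_cases hx : x = v
    · subst hx
      exact p.end_mem_tail_support hp.not_nil
    · exact (List.mem_cons.1 (p.cons_tail_support ▸ hall x)).resolve_left hx
  · ext e
    induction e with
    | h x y =>
      have : H.LocallyFinite := fun x => Fintype.ofFinite _
      rw [← p.edgeSet_toSubgraph, Subgraph.mem_edgeSet, mem_edgeSet]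
      exact hp.adj_toSubgraph_iff_of_isCycles h.isCycles (by simpa using hall x) y

lemma comap (h : H.IsSpanningCycle) (e : W ≃ V) : (H.comap e).IsSpanningCycle := by
  refine ⟨(Iso.comap e H).connected_iff.2 h.1, fun w => ?_⟩
  rw [← h.2 (e w), ← Set.ncard_image_of_injective _ e.injective]
  congr 1
  ext x
  constructor
  · rintro ⟨y, hy, rfl⟩
    exact hy
  · intro hx
    exact ⟨e.symm x, by simpa using hx, by simp⟩

end IsSpanningCycle

/-- The edges of `G` are partitioned into two spanning cycles and a perfect matching, all regarded
as spanning subgraphs. -/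
def HasSpanningDecomposition (G : SimpleGraph V) : Prop :=
  ∃ H₁ H₂ M : SimpleGraph V, H₁.IsSpanningCycle ∧ H₂.IsSpanningCycle ∧ (∀ v, ∃! w, M.Adj v w) ∧
    Disjoint H₁ H₂ ∧ Disjoint H₁ M ∧ Disjoint H₂ M ∧ H₁ ⊔ H₂ ⊔ M = G

lemma HasSpanningDecomposition.comap {G : SimpleGraph V} (h : G.HasSpanningDecomposition)
    (e : W ≃ V) : (G.comap e).HasSpanningDecomposition := by
  obtain ⟨H₁, H₂, M, h1, h2, h3, h4, h5, h6, rfl⟩ := h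
  simp only [disjoint_left] at h4 h5 h6
  refine ⟨H₁.comap e, H₂.comap e, M.comap e, h1.comap e, h2.comap e, fun w => ?_, ?_, ?_, ?_, ?_⟩
  · obtain ⟨x, hx, hx'⟩ := h3 (e w)
    exact ⟨e.symm x, by simpa using hx, fun y hy => by rw [← hx' (e y) hy]; simp⟩
  · exact disjoint_left.2 fun x y => h4 (e x) (e y)
  · exact disjoint_left.2 fun x y => h5 (e x) (e y)
  · exact disjoint_left.2 fun x y => h6 (e x) (e y)
  · ext x y
    rfl

lemma HasSpanningDecomposition.hasTwoHamiltonCyclesMatchingDecomposition [Finite V]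
    [DecidableEq V] {G : SimpleGraph V} (h : G.HasSpanningDecomposition) :
    G.HasTwoHamiltonCyclesMatchingDecomposition := by
  obtain ⟨H₁, H₂, M, h1, h2, h3, h4, h5, h6, rfl⟩ := h
  obtain ⟨u, p, hp, hpe⟩ := h1.exists_isHamiltonianCycle
  obtain ⟨v, q, hq, hqe⟩ := h2.exists_isHamiltonianCycle
  have hle1 : H₁ ≤ H₁ ⊔ H₂ ⊔ M := le_sup_left.trans le_sup_left
  have hle2 : H₂ ≤ H₁ ⊔ H₂ ⊔ M := le_sup_right.trans le_sup_left
  have hle3 : M ≤ H₁ ⊔ H₂ ⊔ M := le_sup_right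
  have edges_map : ∀ {H : SimpleGraph V} (hle : H ≤ H₁ ⊔ H₂ ⊔ M) {u : V} (p : H.Walk u u),
      p.edgeSet = H.edgeSet → (p.mapLe hle).edgeSet = H.edgeSet := by
    intro H hle u p hp
    rw [← hp]
    ext e
    simp [Walk.mem_edgeSet]
  refine ⟨u, v, p.mapLe hle1, q.mapLe hle2, toSubgraph M hle3,
    hp.map Function.bijective_id, hq.map Function.bijective_id,
    Subgraph.isPerfectMatching_iff.2 h3, ?_⟩
  have hM : (toSubgraph M hle3).edgeSet = M.edgeSet := by
    ext e
    induction e with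
    | h x y => rfl
  rw [edges_map hle1 p hpe, edges_map hle2 q hqe, hM, edgeSet_sup, edgeSet_sup]
  exact ⟨disjoint_edgeSet.2 h4, disjoint_edgeSet.2 h5, disjoint_edgeSet.2 h6, rfl⟩

/-! ### Prisms -/

/-- Two copies of `H` in which the edge `uv` of each copy is replaced by the two edges joining the
copies of `u` and the copies of `v`. -/
def prismSwitch (H : SimpleGraph V) (u v : V) : SimpleGraph (V × Bool) where
  Adj x y := (x.2 = y.2 ∧ H.Adj x.1 y.1 ∧ s(x.1, y.1) ≠ s(u, v)) ∨
    (x.1 = y.1 ∧ x.2 ≠ y.2 ∧ (x.1 = u ∨ x.1 = v))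
  symm := ⟨fun x y h => by
    rcases h with ⟨a, b, c⟩ | ⟨a, b, c⟩
    · exact .inl ⟨a.symm, b.symm, by rwa [Sym2.eq_swap]⟩
    · exact .inr ⟨a.symm, b.symm, a ▸ c⟩⟩
  loopless := ⟨fun x h => by
    rcases h with ⟨a, b, c⟩ | ⟨a, b, c⟩
    · exact b.ne rfl
    · exact b rfl⟩

lemma IsSpanningCycle.prismSwitch [Finite V] {H : SimpleGraph V} (h : H.IsSpanningCycle) {u v : V}
    (huv : H.Adj u v) : (H.prismSwitch u v).IsSpanningCycle := by
  constructor
  · have layer : ∀ x y b, (H.prismSwitch u v).Reachable (x, b) (y, b) := by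
      intro x y b
      let f : H.deleteEdges {s(u, v)} →g H.prismSwitch u v :=
        ⟨fun x => (x, b), fun {x y} hxy => by
          rw [deleteEdges_adj] at hxy
          exact .inl ⟨rfl, hxy.1, hxy.2⟩⟩
      exact ((h.connected_deleteEdges huv).preconnected x y).map f
    have cross : (H.prismSwitch u v).Adj (u, true) (u, false) :=
      .inr ⟨rfl, by simp, .inl rfl⟩
    have all : ∀ x, (H.prismSwitch u v).Reachable (u, true) x := by
      rintro ⟨x, _ | _⟩
      · exact cross.reachable.trans (layer _ _ _)
      · exact layer _ _ _
    have : Nonempty (V × Bool) := ⟨(u, true)⟩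
    exact ⟨fun x y => (all x).symm.trans (all y)⟩
  · have key : ∀ u v : V, H.Adj u v → ∀ b, ((H.prismSwitch u v).neighborSet (u, b)).ncard = 2 := by
      intro u v huv b
      have : (H.prismSwitch u v).neighborSet (u, b) =
          insert (u, !b) ((fun x => (x, b)) '' (H.neighborSet u \ {v})) := by
        ext ⟨y, b'⟩
        simp only [SimpleGraph.prismSwitch, mem_neighborSet, Set.mem_insert_iff, Set.mem_image,
          Set.mem_sdiff, Set.mem_singleton_iff, Prod.mk.injEq]
        constructor
        · rintro (⟨rfl, h1, h2⟩ | ⟨rfl, h1, -⟩)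
          · exact .inr ⟨y, ⟨h1, fun e => h2 (by rw [e])⟩, rfl, rfl⟩
          · refine .inl ⟨rfl, ?_⟩
            cases b <;> cases b' <;> simp_all
        · rintro (⟨rfl, rfl⟩ | ⟨y, ⟨h1, h2⟩, rfl, rfl⟩)
          · exact .inr ⟨rfl, by simp, .inl trivial⟩
          · refine .inl ⟨rfl, h1, fun e => h2 ?_⟩
            rw [Sym2.eq_iff] at e
            exact e.elim (·.2) fun e => e.2.trans e.1
      rw [this, Set.ncard_insert_of_notMem, Set.ncard_image_of_injective _
        (fun x y e => (Prod.mk.inj e).1), Set.ncard_sdiff_singleton_of_mem (show v ∈ H.neighborSet u from huv), h.2]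
      rintro ⟨x, -, e⟩
      simp at e
    have comm : H.prismSwitch u v = H.prismSwitch v u := by
      ext x y
      simp only [SimpleGraph.prismSwitch, Sym2.eq_swap (a := u) (b := v), or_comm (a := x.1 = u)]
    rintro ⟨x, b⟩
    by_cases hxu : x = u
    · rw [hxu]; exact key u v huv b
    by_cases hxv : x = v
    · rw [hxv, comm]; exact key v u huv.symm b
    have : (H.prismSwitch u v).neighborSet (x, b) = (fun x => (x, b)) '' H.neighborSet x := by
      ext ⟨y, b'⟩
      simp only [SimpleGraph.prismSwitch, mem_neighborSet, Set.mem_image, Prod.mk.injEq]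
      constructor
      · rintro (⟨rfl, h1, h2⟩ | ⟨rfl, h1, h2⟩)
        · exact ⟨y, h1, rfl, rfl⟩
        · exact absurd h2 (by simp [hxu, hxv])
      · rintro ⟨y, h1, rfl, rfl⟩
        refine .inl ⟨rfl, h1, fun e => ?_⟩
        rw [Sym2.eq_iff] at e
        tauto
    rw [this, Set.ncard_image_of_injective _ (fun x y e => (Prod.mk.inj e).1), h.2]

/-- An edge of one spanning cycle misses some edge of an edge-disjoint spanning cycle. -/
lemma IsSpanningCycle.exists_adj_avoiding [Finite V] {H₁ H₂ : SimpleGraph V}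
    (h1 : H₁.IsSpanningCycle) (h2 : H₂.IsSpanningCycle) (hd : Disjoint H₁ H₂) (u v : V) :
    ∃ w z, H₂.Adj w z ∧ w ≠ u ∧ w ≠ v ∧ z ≠ u ∧ z ≠ v := by
  by_contra! hc
  have pair_le : ({u, v} : Set V).ncard ≤ 2 :=
    (Set.ncard_insert_le u {v}).trans (by rw [Set.ncard_singleton])
  -- The vertex `u`, its two neighbours in `H₁` and its two in `H₂` are distinct.
  have hcard : 5 ≤ Nat.card V := by
    have hdis : Disjoint (H₁.neighborSet u) (H₂.neighborSet u) :=
      Set.disjoint_left.2 fun x hx hx' => disjoint_left.1 hd u x hx hx'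
    have : (insert u (H₁.neighborSet u ∪ H₂.neighborSet u)).ncard = 5 := by
      rw [Set.ncard_insert_of_notMem (by simp), Set.ncard_union_eq hdis, h1.2, h2.2]
    rw [← this]
    exact Set.ncard_le_card _
  -- A vertex outside `{u, v}` would have `u` and `v` as its two neighbours in `H₂`, so at least
  -- three vertices would be adjacent to `u`.
  have hsub : ({u, v}ᶜ : Set V) ⊆ H₂.neighborSet u := by
    intro w hw
    simp only [Set.mem_compl_iff, Set.mem_insert_iff, Set.mem_singleton_iff, not_or] at hw
    have hN : H₂.neighborSet w ⊆ {u, v} := by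
      intro z hz
      by_cases hzu : z = u
      · exact .inl hzu
      · exact .inr (hc w z hz hw.1 hw.2 hzu)
    have hle : ({u, v} : Set V).ncard ≤ (H₂.neighborSet w).ncard := by
      rw [h2.2]; exact pair_le
    have := Set.eq_of_subset_of_ncard_le hN hle
    have hu : u ∈ H₂.neighborSet w := by rw [this]; exact .inl rfl
    exact (H₂.mem_neighborSet w u).1 hu |>.symm
  have h3 := Set.ncard_le_ncard hsub
  rw [h2.2 u] at h3
  have h4 := Set.ncard_add_ncard_compl ({u, v} : Set V)
  omega

/-- The prism over a graph that decomposes into two spanning cycles. -/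
lemma hasSpanningDecomposition_prism [Finite V] {H₁ H₂ : SimpleGraph V}
    (h1 : H₁.IsSpanningCycle) (h2 : H₂.IsSpanningCycle) (hd : Disjoint H₁ H₂)
    {X : SimpleGraph (V × Bool)} (hX : ∀ x y : V × Bool, X.Adj x y ↔
      (x.2 = y.2 ∧ (H₁ ⊔ H₂).Adj x.1 y.1) ∨ (x.1 = y.1 ∧ x.2 ≠ y.2)) :
    X.HasSpanningDecomposition := by
  obtain ⟨u⟩ := h1.1.nonempty
  obtain ⟨v, huv⟩ : (H₁.neighborSet u).Nonempty :=
    Set.nonempty_of_ncard_ne_zero (by rw [h1.2 u]; norm_num)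
  obtain ⟨w, z, hwz, hwu, hwv, hzu, hzv⟩ := h1.exists_adj_avoiding h2 hd u v
  have hd' := disjoint_left.1 hd
  have huv' : H₁.Adj u v := huv
  -- The edges left over: both copies of `uv` and of `wz`, and the rungs away from these four
  -- vertices. They form a matching because `uv` and `wz` have no common end.
  let M : SimpleGraph (V × Bool) :=
    { Adj := fun x y => (x.2 = y.2 ∧ (s(x.1, y.1) = s(u, v) ∨ s(x.1, y.1) = s(w, z))) ∨
        (x.1 = y.1 ∧ x.2 ≠ y.2 ∧ x.1 ≠ u ∧ x.1 ≠ v ∧ x.1 ≠ w ∧ x.1 ≠ z)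
      symm := ⟨fun x y h => by
        rcases h with ⟨a, b⟩ | ⟨a, b, c⟩
        · exact .inl ⟨a.symm, by rwa [Sym2.eq_swap]⟩
        · exact .inr ⟨a.symm, b.symm, a ▸ c⟩⟩
      loopless := ⟨fun x h => by
        rcases h with ⟨a, b | b⟩ | ⟨a, b, c⟩
        · rw [Sym2.eq_iff] at b
          rcases b with ⟨b, c⟩ | ⟨b, c⟩
          · exact huv'.ne (b.symm.trans c)
          · exact huv'.ne (c.symm.trans b)
        · rw [Sym2.eq_iff] at b
          rcases b with ⟨b, c⟩ | ⟨b, c⟩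
          · exact hwz.ne (b.symm.trans c)
          · exact hwz.ne (c.symm.trans b)
        · exact b rfl⟩ }
  refine ⟨H₁.prismSwitch u v, H₂.prismSwitch w z, M, h1.prismSwitch huv, h2.prismSwitch hwz,
    ?_, ?_, ?_, ?_, ?_⟩
  · rintro ⟨x, b⟩
    have hne := huv'.ne
    have hne' := hwz.ne
    by_cases c1 : x = u
    · subst c1
      refine ⟨(v, b), .inl ⟨rfl, .inl rfl⟩, ?_⟩
      rintro ⟨y, b'⟩ (⟨e, e'⟩ | ⟨-, -, e, -⟩)
      · simp only [Sym2.eq_iff] at e e'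
        grind
      · exact absurd rfl e
    by_cases c2 : x = v
    · subst c2
      refine ⟨(u, b), .inl ⟨rfl, .inl Sym2.eq_swap⟩, ?_⟩
      rintro ⟨y, b'⟩ (⟨e, e'⟩ | ⟨-, -, -, e, -⟩)
      · simp only [Sym2.eq_iff] at e e'
        grind
      · exact absurd rfl e
    by_cases c3 : x = w
    · subst c3
      refine ⟨(z, b), .inl ⟨rfl, .inr rfl⟩, ?_⟩
      rintro ⟨y, b'⟩ (⟨e, e'⟩ | ⟨-, -, -, -, e, -⟩)
      · simp only [Sym2.eq_iff] at e e'
        grind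
      · exact absurd rfl e
    by_cases c4 : x = z
    · subst c4
      refine ⟨(w, b), .inl ⟨rfl, .inr Sym2.eq_swap⟩, ?_⟩
      rintro ⟨y, b'⟩ (⟨e, e'⟩ | ⟨-, -, -, -, -, e⟩)
      · simp only [Sym2.eq_iff] at e e'
        grind
      · exact absurd rfl e
    refine ⟨(x, !b), .inr ⟨rfl, by simp, c1, c2, c3, c4⟩, ?_⟩
    rintro ⟨y, b'⟩ (⟨e, e'⟩ | ⟨e, e', -⟩)
    · simp only [Sym2.eq_iff] at e'
      grind
    · simp only at e e'
      subst e
      cases b <;> cases b' <;> simp_all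
  · refine disjoint_left.2 fun x y a b => ?_
    rcases a with ⟨a1, a2, a3⟩ | ⟨a1, a2, a3⟩ <;> rcases b with ⟨b1, b2, b3⟩ | ⟨b1, b2, b3⟩
    · exact hd' _ _ a2 b2
    · exact b2 a1
    · exact a2 b1
    · rcases a3 with a3 | a3 <;> rcases b3 with b3 | b3 <;> grind
  · refine disjoint_left.2 fun x y a b => ?_
    rcases a with ⟨a1, a2, a3⟩ | ⟨a1, a2, a3⟩ <;> rcases b with ⟨b1, b2⟩ | ⟨b1, b2, b3⟩
    · rcases b2 with b2 | b2
      · exact a3 b2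
      · have : s(x.1, y.1) ∈ H₁.edgeSet := a2
        rw [b2] at this
        exact hd' _ _ this hwz
    · exact b2 a1
    · exact a2 b1
    · exact a3.elim b3.1 b3.2.1
  · refine disjoint_left.2 fun x y a b => ?_
    rcases a with ⟨a1, a2, a3⟩ | ⟨a1, a2, a3⟩ <;> rcases b with ⟨b1, b2⟩ | ⟨b1, b2, b3⟩
    · rcases b2 with b2 | b2
      · have : s(x.1, y.1) ∈ H₂.edgeSet := a2
        rw [b2] at this
        exact hd' _ _ huv' this
      · exact a3 b2
    · exact b2 a1
    · exact a2 b1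
    · exact a3.elim b3.2.2.1 b3.2.2.2
  · ext x y
    rw [hX]
    have e1 : s(x.1, y.1) = s(u, v) → H₁.Adj x.1 y.1 := fun e => by
      rw [← mem_edgeSet, e]; exact huv'
    have e2 : s(x.1, y.1) = s(w, z) → H₂.Adj x.1 y.1 := fun e => by
      rw [← mem_edgeSet, e]; exact hwz
    change (((x.2 = y.2 ∧ H₁.Adj x.1 y.1 ∧ s(x.1, y.1) ≠ s(u, v)) ∨
      (x.1 = y.1 ∧ x.2 ≠ y.2 ∧ (x.1 = u ∨ x.1 = v))) ∨
      ((x.2 = y.2 ∧ H₂.Adj x.1 y.1 ∧ s(x.1, y.1) ≠ s(w, z)) ∨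
      (x.1 = y.1 ∧ x.2 ≠ y.2 ∧ (x.1 = w ∨ x.1 = z)))) ∨
      ((x.2 = y.2 ∧ (s(x.1, y.1) = s(u, v) ∨ s(x.1, y.1) = s(w, z))) ∨
        (x.1 = y.1 ∧ x.2 ≠ y.2 ∧ x.1 ≠ u ∧ x.1 ≠ v ∧ x.1 ≠ w ∧ x.1 ≠ z)) ↔
      (x.2 = y.2 ∧ (H₁.Adj x.1 y.1 ∨ H₂.Adj x.1 y.1)) ∨ (x.1 = y.1 ∧ x.2 ≠ y.2)
    by_cases k1 : s(x.1, y.1) = s(u, v) <;> by_cases k2 : s(x.1, y.1) = s(w, z) <;>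
      simp only [k1, k2] at e1 e2 ⊢ <;> grind

end SimpleGraph

/-! ### Pair walks and quotients of `ℤ × ℤ` -/

/-- A bi-infinite walk in a commutative group whose steps are `a` or `a'` at every vertex, and
which is compatible with differences of indices that are divisible by `t`. -/
structure IsPairWalk {Γ : Type*} [CommGroup Γ] (w : ℤ → Γ) (a a' : Γ) (t : ℤ) : Prop where
  zero : w 0 = 1
  one : w 1 = a
  neg_one : w (-1) = a'
  two : w 2 ≠ 1
  step : ∀ i v, (v = w (i + 1) ∨ v = w (i - 1)) ↔ (v = w i * a ∨ v = w i * a')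
  sub : ∀ i j, ∃ k, w i = w k * w j ∧ (t ∣ i - j ↔ t ∣ k) ∧ (t ∣ i - j → k = i - j)

section PairWalk

variable {Γ : Type*} [CommGroup Γ]

lemma isPairWalk_zpow {a : Γ} (ha : a * a ≠ 1) : IsPairWalk (fun i => a ^ i) a a⁻¹ 1 where
  zero := zpow_zero a
  one := zpow_one a
  neg_one := zpow_neg_one a
  two := by rwa [zpow_two]
  step i v := by rw [zpow_add_one, zpow_sub_one]
  sub i j := ⟨i - j, by rw [← zpow_add, sub_add_cancel], Iff.rfl, fun _ => rfl⟩

/-- The walk with alternating steps `a` and `b`. -/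
def alternatingWalk (a b : Γ) (i : ℤ) : Γ := a ^ ((i + 1) / 2) * b ^ (i / 2)

lemma alternatingWalk_even (a b : Γ) (k : ℤ) : alternatingWalk a b (2 * k) = a ^ k * b ^ k := by
  rw [alternatingWalk]
  congr 2 <;> omega

lemma alternatingWalk_odd (a b : Γ) (k : ℤ) :
    alternatingWalk a b (2 * k + 1) = a ^ (k + 1) * b ^ k := by
  rw [alternatingWalk]
  congr 2 <;> omega

/-- The walk runs through `1`, `a`, `a * b`, `b` periodically. An even shift by `2 * m` multiplies
by `(a * b) ^ m`. An odd shift multiplies by `a` or `b` depending on the position, so only the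
parity of `k` is controlled. -/
lemma isPairWalk_alternatingWalk {a b : Γ} (ha : a * a = 1) (hb : b * b = 1) (hab : a ≠ b) :
    IsPairWalk (alternatingWalk a b) a b 2 where
  zero := by simp [alternatingWalk]
  one := by simp [alternatingWalk]
  neg_one := by
    rw [show (-1 : ℤ) = 2 * (-1) + 1 by norm_num, alternatingWalk_odd]
    simp [inv_eq_of_mul_eq_one_left hb]
  two := by
    rw [show (2 : ℤ) = 2 * 1 by norm_num, alternatingWalk_even, zpow_one, zpow_one]
    intro h
    exact hab (mul_right_cancel (h.trans hb.symm))
  step i v := by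
    have ha' : a ^ (-1 : ℤ) = a := by rw [zpow_neg_one, inv_eq_of_mul_eq_one_left ha]
    have hb' : b ^ (-1 : ℤ) = b := by rw [zpow_neg_one, inv_eq_of_mul_eq_one_left hb]
    rcases Int.even_or_odd' i with ⟨k, rfl | rfl⟩
    · rw [show 2 * k - 1 = 2 * (k + -1) + 1 by ring, alternatingWalk_odd, alternatingWalk_odd,
        alternatingWalk_even, zpow_add_one, neg_add_cancel_right, zpow_add b, hb',
        mul_right_comm, ← mul_assoc]
    · rw [show 2 * k + 1 + 1 = 2 * (k + 1) by ring, add_sub_cancel_right, alternatingWalk_odd,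
        alternatingWalk_even, alternatingWalk_even, zpow_add_one b, zpow_add_one a, or_comm,
        mul_right_comm (a ^ k) a (b ^ k), mul_assoc _ a a, ha, mul_one, mul_assoc (a ^ k) a,
        mul_comm a, ← mul_assoc, ← mul_assoc, mul_right_comm _ b a]
  sub i j := by
    rcases Int.even_or_odd' i with ⟨k, rfl | rfl⟩ <;> rcases Int.even_or_odd' j with ⟨l, rfl | rfl⟩
    · refine ⟨2 * (k - l), ?_, by omega, by omega⟩
      simp only [alternatingWalk_even, zpow_sub]
      rw [mul_mul_mul_comm, inv_mul_cancel_right, inv_mul_cancel_right]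
    · refine ⟨2 * (k - l) + 1, ?_, by omega, by omega⟩
      have ha2 : a ^ (2 : ℤ) = 1 := by rw [zpow_two, ha]
      rw [alternatingWalk_even, alternatingWalk_odd, alternatingWalk_odd, mul_mul_mul_comm,
        ← zpow_add, ← zpow_add, show k - l + 1 + (l + 1) = k + 2 by ring, sub_add_cancel, zpow_add,
        ha2, mul_one]
    · refine ⟨2 * (k - l) + 1, ?_, by omega, by omega⟩
      rw [alternatingWalk_even, alternatingWalk_odd, alternatingWalk_odd, mul_mul_mul_comm,
        ← zpow_add, ← zpow_add, show k - l + 1 + l = k + 1 by ring, sub_add_cancel]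
    · refine ⟨2 * (k - l), ?_, by omega, by omega⟩
      rw [alternatingWalk_even, alternatingWalk_odd, alternatingWalk_odd, mul_mul_mul_comm,
        ← zpow_add, ← zpow_add, show k - l + (l + 1) = k + 1 by ring, sub_add_cancel]

lemma alternatingWalk_mem {a b : Γ} (ha : a * a = 1) (hb : b * b = 1) (i : ℤ) :
    (2 ∣ i ∧ (alternatingWalk a b i = 1 ∨ alternatingWalk a b i = a * b)) ∨
      (¬ 2 ∣ i ∧ (alternatingWalk a b i = a ∨ alternatingWalk a b i = b)) := by
  have ha2 : a ^ (2 : ℤ) = 1 := by rw [zpow_two, ha]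
  have hb2 : b ^ (2 : ℤ) = 1 := by rw [zpow_two, hb]
  rcases Int.even_or_odd' i with ⟨k, rfl | rfl⟩ <;> rcases Int.even_or_odd' k with ⟨l, rfl | rfl⟩
  · refine .inl ⟨by omega, .inl ?_⟩
    rw [alternatingWalk_even, zpow_mul, zpow_mul, ha2, hb2, one_zpow, one_mul]
  · refine .inl ⟨by omega, .inr ?_⟩
    rw [alternatingWalk_even, zpow_add_one, zpow_add_one, zpow_mul, zpow_mul, ha2, hb2, one_zpow,
      one_mul, one_mul]
  · refine .inr ⟨by omega, .inl ?_⟩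
    rw [alternatingWalk_odd, zpow_add_one, zpow_mul, zpow_mul, ha2, hb2, one_zpow, one_mul, mul_one]
  · refine .inr ⟨by omega, .inr ?_⟩
    rw [alternatingWalk_odd, zpow_add_one, zpow_add_one, zpow_add_one, zpow_mul, zpow_mul, ha2, hb2,
      one_zpow, one_mul, one_mul, ha, one_mul]

/-- Two pair walks span a subset of the group isomorphic to the Cayley graph of a quotient of
`ℤ × ℤ`, which decomposes into two Hamilton cycles. -/
lemma exists_spanningCycles_of_isPairWalk [Finite Γ] {w w' : ℤ → Γ} {a a' b b' : Γ} {t t' : ℤ}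
    (hw : IsPairWalk w a a' t) (hw' : IsPairWalk w' b b' t')
    (hdvd : ∀ i j, w i * w' j = 1 → t ∣ i ∧ t' ∣ j) (hab : a ≠ b) (hab' : a ≠ b') :
    ∃ (A : Type) (_ : Finite A) (F : A → Γ) (H₁ H₂ : SimpleGraph A), F.Injective ∧
      1 ∈ Set.range F ∧
      (∀ x, ∀ g ∈ ({a, a', b, b'} : Set Γ), ∃ y, F y = F x * g) ∧
      H₁.IsSpanningCycle ∧ H₂.IsSpanningCycle ∧ Disjoint H₁ H₂ ∧
      ∀ x y, (H₁ ⊔ H₂).Adj x y ↔ ∃ g ∈ ({a, a', b, b'} : Set Γ), F y = F x * g := by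
  let f : ℤ × ℤ → Γ := fun x => w x.1 * w' x.2
  -- The map `f` need not be a homomorphism. By `hdvd`, the value `1` is taken only at pairs of
  -- indices divisible by `t` and `t'`, and such shifts are respected. Hence the fibres of `f` are
  -- the cosets of a subgroup.
  have f_sub : ∀ x y, ∃ z, f x = f z * f y ∧ (f z = 1 ∨ f (x - y) = 1 → z = x - y) := by
    intro x y
    obtain ⟨k, h1, h2, h3⟩ := hw.sub x.1 y.1
    obtain ⟨l, h1', h2', h3'⟩ := hw'.sub x.2 y.2
    refine ⟨(k, l), ?_, ?_⟩
    · simp only [f]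
      rw [h1, h1', mul_mul_mul_comm]
    · rintro (h | h)
      · obtain ⟨d, d'⟩ := hdvd _ _ h
        exact Prod.ext (h3 (h2.2 d)) (h3' (h2'.2 d'))
      · obtain ⟨d, d'⟩ := hdvd _ _ h
        exact Prod.ext (h3 d) (h3' d')
  have f_eq : ∀ x y, f x = f y ↔ f (x - y) = 1 := by
    intro x y
    obtain ⟨z, hz, hz'⟩ := f_sub x y
    rw [hz, mul_eq_right]
    constructor
    · intro h
      rwa [← hz' (.inl h)]
    · intro h
      rwa [hz' (.inr h)]
  have f_zero : f 0 = 1 := by simp [f, hw.zero, hw'.zero]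
  let Λ : AddSubgroup (ℤ × ℤ) :=
    { carrier := {x | f x = 1}
      zero_mem' := f_zero
      add_mem' := fun {x y} hx hy => by
        have : f (x + y) = f y := by
          rw [f_eq, add_sub_cancel_right]
          exact hx
        exact this.trans hy
      neg_mem' := fun {x} hx => by
        have : f 0 = f x := by rw [f_zero]; exact hx.symm
        rwa [f_eq, zero_sub] at this }
  have rel : ∀ x y : ℤ × ℤ, (x : (ℤ × ℤ) ⧸ Λ) = y ↔ f x = f y := by
    intro x y
    rw [eq_comm, f_eq, QuotientAddGroup.eq, neg_add_eq_sub]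
    rfl
  let F : (ℤ × ℤ) ⧸ Λ → Γ := Quotient.lift f fun x y h => (rel x y).1 (Quotient.sound h)
  have F_mk : ∀ x : ℤ × ℤ, F x = f x := fun _ => rfl
  have F_inj : F.Injective := by
    intro x y h
    induction x using QuotientAddGroup.induction_on with
    | H x =>
      induction y using QuotientAddGroup.induction_on with
      | H y => exact (rel x y).2 h
  have hfin : Finite ((ℤ × ℤ) ⧸ Λ) := Finite.of_injective F F_inj
  let r : (ℤ × ℤ) ⧸ Λ := ((1, 0) : ℤ × ℤ)
  let s : (ℤ × ℤ) ⧸ Λ := ((0, 1) : ℤ × ℤ)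
  have step : ∀ x v, ((v = F (x + r) ∨ v = F (x - r)) ∨ (v = F (x + s) ∨ v = F (x - s))) ↔
      ∃ g ∈ ({a, a', b, b'} : Set Γ), v = F x * g := by
    intro x v
    induction x using QuotientAddGroup.induction_on with
    | H x =>
      obtain ⟨i, j⟩ := x
      have e1 : F (((i, j) : ℤ × ℤ) + r) = w (i + 1) * w' j := by
        change w (i + 1) * w' (j + 0) = _
        rw [add_zero]
      have e2 : F (((i, j) : ℤ × ℤ) - r) = w (i - 1) * w' j := by
        change w (i - 1) * w' (j - 0) = _
        rw [sub_zero]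
      have e3 : F (((i, j) : ℤ × ℤ) + s) = w i * w' (j + 1) := by
        change w (i + 0) * w' (j + 1) = _
        rw [add_zero]
      have e4 : F (((i, j) : ℤ × ℤ) - s) = w i * w' (j - 1) := by
        change w (i - 0) * w' (j - 1) = _
        rw [sub_zero]
      have e5 : F ((i, j) : ℤ × ℤ) = w i * w' j := rfl
      rw [e1, e2, e3, e4, e5]
      have h1 := hw.step i (v * (w' j)⁻¹)
      have h2 := hw'.step j ((w i)⁻¹ * v)
      simp only [mul_inv_eq_iff_eq_mul, inv_mul_eq_iff_eq_mul] at h1 h2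
      rw [h1, h2]
      simp only [Set.mem_insert_iff, Set.mem_singleton_iff, exists_eq_or_imp, exists_eq_left,
        mul_right_comm _ _ (w' j), ← mul_assoc, or_assoc]
  have hr1 : F r = a := by
    change w 1 * w' 0 = a
    rw [hw.one, hw'.zero, mul_one]
  have hs1 : F s = b := by
    change w 0 * w' 1 = b
    rw [hw.zero, hw'.one, one_mul]
  have hs2 : F (-s) = b' := by
    change w (-0) * w' (-1) = b'
    rw [neg_zero, hw.zero, hw'.neg_one, one_mul]
  have F_zero : F 0 = 1 := f_zero
  obtain ⟨H₁, H₂, h1, h2, h3, h4⟩ := exists_decomposition_of_two_generators (r := r) (s := s)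
    (fun x => by
      induction x using QuotientAddGroup.induction_on with
      | H x =>
        obtain ⟨i, j⟩ := x
        refine ⟨i, j, ?_⟩
        change ((i, j) : ℤ × ℤ) = ((i • ((1, 0) : ℤ × ℤ) + j • ((0, 1) : ℤ × ℤ) : ℤ × ℤ) :
          (ℤ × ℤ) ⧸ Λ)
        congr 1
        simp)
    (fun h => hw.two (by
      have : F (r + r) = w 2 * w' 0 := rfl
      rw [h, F_zero, hw'.zero, mul_one] at this
      exact this.symm))
    (fun h => hw'.two (by
      have : F (s + s) = w 0 * w' 2 := rfl
      rw [h, F_zero, hw.zero, one_mul] at this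
      exact this.symm))
    (fun h => hab (by rw [← hr1, ← hs1, h]))
    (fun h => hab' (by rw [← hr1, ← hs2, eq_neg_of_add_eq_zero_left h]))
  refine ⟨(ℤ × ℤ) ⧸ Λ, hfin, F, H₁, H₂, F_inj, ⟨0, F_zero⟩, ?_, h1, h2, h3, ?_⟩
  · intro x g hg
    rcases (step x (F x * g)).2 ⟨g, hg, rfl⟩ with (h | h) | (h | h) <;> exact ⟨_, h.symm⟩
  · intro x y
    rw [h4, ← step]
    simp only [F_inj.eq_iff]

end PairWalk

/-! ### Restoring the removed involution -/

section Cayley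

variable {Γ : Type*} [CommGroup Γ]

lemma mulCayley_adj_iff_exists {S : Set Γ} (one_notMem : (1 : Γ) ∉ S)
    (inv_mem : ∀ s ∈ S, s⁻¹ ∈ S) (u v : Γ) :
    (SimpleGraph.mulCayley S).Adj u v ↔ ∃ g ∈ S, v = u * g := by
  rw [SimpleGraph.mulCayley_adj]
  constructor
  · rintro ⟨-, h | h⟩
    · exact ⟨_, h, by simp⟩
    · exact ⟨_, inv_mem _ h, by simp⟩
  · rintro ⟨g, hg, rfl⟩
    refine ⟨fun h => one_notMem ?_, .inl (by simpa using hg)⟩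
    rw [left_eq_mul] at h
    rwa [h] at hg

/-- Removing an involution `e` from the connection set leaves a `4`-regular graph each of whose
components decomposes into two Hamilton cycles. -/
lemma hasSpanningDecomposition_of_isPairWalk [Finite Γ] {S : Set Γ} {e a a' b b' : Γ}
    (hS : S = insert e {a, a', b, b'}) (one_notMem : (1 : Γ) ∉ S) (inv_mem : ∀ s ∈ S, s⁻¹ ∈ S)
    (connected : (SimpleGraph.mulCayley S).Connected) (he : e * e = 1)
    (heT : e ∉ ({a, a', b, b'} : Set Γ)) {w w' : ℤ → Γ} {t t' : ℤ}
    (hw : IsPairWalk w a a' t) (hw' : IsPairWalk w' b b' t')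
    (hdvd : ∀ i j, w i * w' j = 1 → t ∣ i ∧ t' ∣ j) (hab : a ≠ b) (hab' : a ≠ b') :
    (SimpleGraph.mulCayley S).HasSpanningDecomposition := by
  obtain ⟨A, hA, F, H₁, H₂, F_inj, ⟨x₀, hx₀⟩, F_mul, h1, h2, hd, hadj⟩ :=
    exists_spanningCycles_of_isPairWalk hw hw' hdvd hab hab'
  have cay := mulCayley_adj_iff_exists one_notMem inv_mem
  have hST : ∀ g, g ∈ S ↔ g = e ∨ g ∈ ({a, a', b, b'} : Set Γ) := fun g => by
    rw [hS, Set.mem_insert_iff]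
  generalize ({a, a', b, b'} : Set Γ) = T at *
  have he' : e⁻¹ = e := inv_eq_of_mul_eq_one_left he
  have T_inv : ∀ g ∈ T, g⁻¹ ∈ T := by
    intro g hg
    refine ((hST _).1 (inv_mem g ((hST g).2 (.inr hg)))).resolve_left fun h => heT ?_
    rwa [← he', ← h, inv_inv]
  let K := Subgroup.closure T
  have mem_range : ∀ v ∈ K, ∃ x, F x = v := by
    intro v hv
    induction hv using Subgroup.closure_induction_right with
    | one => exact ⟨x₀, hx₀⟩
    | mul_right x _ y hy ih =>
      obtain ⟨z, rfl⟩ := ih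
      exact F_mul z y hy
    | mul_inv_cancel x _ y hy ih =>
      obtain ⟨z, rfl⟩ := ih
      exact F_mul z _ (T_inv y hy)
  -- The spanning cycle `H₁` connects every vertex to `x₀`, where `F` is `1`, by steps from `T`.
  have F_mem : ∀ x, F x ∈ K := by
    intro x
    obtain ⟨p⟩ := h1.1.preconnected x x₀
    induction p with
    | nil => rw [hx₀]; exact one_mem K
    | @cons x y z h _ ih =>
      obtain ⟨g, hg, e⟩ := (hadj x y).1 (.inl h)
      have := mul_mem (ih hx₀) (K.inv_mem (Subgroup.subset_closure hg))
      rwa [e, mul_inv_cancel_right] at this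
  -- Along a walk to `1` only steps by `e` leave the coset, and `e * e = 1`, so there are at most
  -- two cosets of `K`.
  have cover : ∀ v, v ∈ K ∨ v * e ∈ K := by
    intro v
    obtain ⟨p⟩ := connected.preconnected v 1
    generalize h1 : (1 : Γ) = o at p
    induction p with
    | nil => exact .inl (h1 ▸ one_mem K)
    | @cons x y z h _ ih =>
      obtain ⟨g, hg, rfl⟩ := (cay x y).1 h
      rcases (hST g).1 hg with rfl | hgT
      · rcases ih h1 with k | k
        · exact .inr k
        · rw [mul_assoc, he, mul_one] at k
          exact .inl k
      · have hgK : g ∈ K := Subgroup.subset_closure hgT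
        rw [mul_right_comm, K.mul_mem_cancel_right hgK, K.mul_mem_cancel_right hgK] at ih
        exact ih h1
  by_cases heK : e ∈ K
  · have F_surj : F.Surjective := fun v => mem_range v <| (cover v).elim id
      fun h => (K.mul_mem_cancel_right heK).1 h
    let φ := Equiv.ofBijective F ⟨F_inj, F_surj⟩
    have hφ : ∀ x, φ x = F x := fun _ => rfl
    have e_ne : e ≠ 1 := fun h => one_notMem (h ▸ (hST e).2 (.inl rfl))
    let M : SimpleGraph A :=
      { Adj := fun x y => F y = F x * e
        symm := ⟨fun x y h => by rw [h, mul_assoc, he, mul_one]⟩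
        loopless := ⟨fun x h => e_ne (by simpa using h)⟩ }
    have hM : ∀ x y, M.Adj x y → ¬ (H₁ ⊔ H₂).Adj x y := by
      intro x y h h'
      obtain ⟨g, hg, h''⟩ := (hadj x y).1 h'
      have : g = e := mul_left_cancel (h''.symm.trans h)
      exact heT (this ▸ hg)
    have dec : ((SimpleGraph.mulCayley S).comap φ).HasSpanningDecomposition := by
      refine ⟨H₁, H₂, M, h1, h2, fun x => ?_, hd, ?_, ?_, ?_⟩
      · obtain ⟨y, hy⟩ := F_surj (F x * e)
        exact ⟨y, hy, fun z hz => F_inj (Eq.trans hz hy.symm)⟩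
      · exact SimpleGraph.disjoint_left.2 fun x y h h' => hM x y h' (.inl h)
      · exact SimpleGraph.disjoint_left.2 fun x y h h' => hM x y h' (.inr h)
      · ext x y
        rw [SimpleGraph.comap_adj, cay, SimpleGraph.sup_adj, hadj]
        simp only [hST, hφ]
        constructor
        · rintro (⟨g, hg, h⟩ | h)
          · exact ⟨g, .inr hg, h⟩
          · exact ⟨e, .inl rfl, h⟩
        · rintro ⟨g, rfl | hg, h⟩
          · exact .inr h
          · exact .inl ⟨g, hg, h⟩
    have := dec.comap φ.symm
    rwa [SimpleGraph.comap_comap, show (φ ∘ φ.symm : Γ → Γ) = id from φ.self_comp_symm,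
      SimpleGraph.comap_id] at this
  · have mul_e : ∀ v ∈ K, v * e ∉ K := fun v hv h => heK ((K.mul_mem_cancel_left hv).1 h)
    let f : A × Bool → Γ := fun x => F x.1 * if x.2 then e else 1
    have f_bij : f.Bijective := by
      constructor
      · rintro ⟨x, _ | _⟩ ⟨y, _ | _⟩ h
        · simp only [f, Bool.false_eq_true, if_false, mul_one] at h
          rw [F_inj h]
        · simp only [f, Bool.false_eq_true, if_false, if_true, mul_one] at h
          exact absurd (h ▸ F_mem x) (mul_e _ (F_mem y))
        · simp only [f, Bool.false_eq_true, if_false, if_true, mul_one] at h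
          exact absurd (h ▸ F_mem y) (mul_e _ (F_mem x))
        · simp only [f, if_true, mul_left_inj] at h
          rw [F_inj h]
      · intro v
        rcases cover v with h | h
        · obtain ⟨x, rfl⟩ := mem_range v h
          exact ⟨(x, false), by simp [f]⟩
        · obtain ⟨x, hx⟩ := mem_range _ h
          exact ⟨(x, true), by simp [f, hx, mul_assoc, he]⟩
    let φ := Equiv.ofBijective f f_bij
    have hφ : ∀ x, φ x = F x.1 * if x.2 then e else 1 := fun _ => rfl
    have T_mem : ∀ g ∈ T, g ∈ K := fun g hg => Subgroup.subset_closure hg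
    have dec : ((SimpleGraph.mulCayley S).comap φ).HasSpanningDecomposition := by
      refine SimpleGraph.hasSpanningDecomposition_prism h1 h2 hd ?_
      have same : ∀ x y, (∃ g, (g = e ∨ g ∈ T) ∧ F y = F x * g) ↔ (H₁ ⊔ H₂).Adj x y := by
        intro x y
        rw [hadj]
        constructor
        · rintro ⟨g, rfl | hg, h⟩
          · exact absurd (h ▸ F_mem y) (mul_e _ (F_mem x))
          · exact ⟨g, hg, h⟩
        · rintro ⟨g, hg, h⟩
          exact ⟨g, .inr hg, h⟩
      have diff : ∀ x y, (∃ g, (g = e ∨ g ∈ T) ∧ F y * e = F x * g) ↔ x = y := by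
        intro x y
        constructor
        · rintro ⟨g, rfl | hg, h⟩
          · exact F_inj (mul_right_cancel h).symm
          · exact absurd (h ▸ mul_mem (F_mem x) (T_mem g hg)) (mul_e _ (F_mem y))
        · rintro rfl
          exact ⟨e, .inl rfl, rfl⟩
      rintro ⟨x, b⟩ ⟨y, b'⟩
      rw [SimpleGraph.comap_adj, cay]
      simp only [hST, hφ]
      cases b <;> cases b'
      · simpa using same x y
      · simpa using diff x y
      · have : ∀ g, F y = F x * e * g ↔ F y * e = F x * g := fun g => by
          rw [mul_right_comm, ← mul_inv_eq_iff_eq_mul, he']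
        simpa [this] using diff x y
      · have : ∀ g, F y * e = F x * e * g ↔ F y = F x * g := fun g => by
          rw [mul_right_comm, mul_left_inj]
        simpa [this] using same x y
    have := dec.comap φ.symm
    rwa [SimpleGraph.comap_comap, show (φ ∘ φ.symm : Γ → Γ) = id from φ.self_comp_symm,
      SimpleGraph.comap_id] at this

/-- If `x ^ i` is an involution, then `2 * i` is an odd multiple of the order of `x`. For two such
exponents the doubled difference is an even multiple, so the order divides the difference itself. -/
lemma eq_of_mem_zpowers_of_mul_self [Finite Γ] {x a b : Γ} (ha : a ∈ Subgroup.zpowers x)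
    (hb : b ∈ Subgroup.zpowers x) (ha2 : a * a = 1) (hb2 : b * b = 1) (ha1 : a ≠ 1)
    (hb1 : b ≠ 1) : a = b := by
  obtain ⟨i, rfl⟩ := Subgroup.mem_zpowers_iff.1 ha
  obtain ⟨j, rfl⟩ := Subgroup.mem_zpowers_iff.1 hb
  rw [← zpow_add, ← orderOf_dvd_iff_zpow_eq_one] at ha2 hb2
  rw [Ne, ← orderOf_dvd_iff_zpow_eq_one] at ha1 hb1
  rw [← mul_inv_eq_one, ← zpow_neg, ← zpow_add, ← orderOf_dvd_iff_zpow_eq_one]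
  obtain ⟨u, hu⟩ := ha2
  obtain ⟨v, hv⟩ := hb2
  have odd : ∀ {i u : ℤ}, ¬ (orderOf x : ℤ) ∣ i → i + i = orderOf x * u → ¬ Even u := by
    rintro i u h hu ⟨k, rfl⟩
    exact h ⟨k, by linarith⟩
  obtain ⟨k, hk⟩ := Int.even_sub.2 (iff_of_false (odd ha1 hu) (odd hb1 hv))
  refine ⟨k, ?_⟩
  have : (orderOf x : ℤ) * (u - v) = orderOf x * (k + k) := by rw [hk]
  linarith

/-- Among five involutions there are four no three of which multiply to `1`. -/
lemma exists_four_involutions {S : Set Γ} (hcard : S.ncard = 5) (one_notMem : (1 : Γ) ∉ S)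
    (hS : ∀ x ∈ S, x * x = 1) : ∃ e a b c d : Γ, S = insert e {a, b, c, d} ∧
      e ∉ ({a, b, c, d} : Set Γ) ∧ a ≠ b ∧ c ≠ d ∧ a ≠ c ∧ a ≠ d ∧ b ≠ c ∧ b ≠ d ∧
      a * b ≠ c ∧ a * b ≠ d ∧ c * d ≠ a ∧ c * d ≠ b := by
  by_cases h : ∃ x ∈ S, ∃ y ∈ S, x ≠ y ∧ x * y ∈ S
  · obtain ⟨x, hx, y, hy, hxy, hz⟩ := h
    have hx2 := hS x hx
    have hy2 := hS y hy
    have hzx : x * y ≠ x := fun h => one_notMem (by rw [mul_eq_left] at h; rwa [h] at hy)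
    have hzy : x * y ≠ y := fun h => one_notMem (by rw [mul_eq_right] at h; rwa [h] at hx)
    have e1 : x * (x * y) = y := by rw [← mul_assoc, hx2, one_mul]
    have e2 : y * (x * y) = x := by rw [mul_left_comm, hy2, mul_one]
    generalize hzdef : x * y = z at *
    have hsub : ({x, y, z} : Set Γ) ⊆ S := by
      rintro g (rfl | rfl | rfl) <;> assumption
    have h3 : ({x, y, z} : Set Γ).ncard = 3 :=
      Set.ncard_eq_three.2 ⟨x, y, z, hxy, hzx.symm, hzy.symm, rfl⟩
    have h2 : (S \ {x, y, z}).ncard = 2 := by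
      rw [Set.ncard_sdiff hsub, hcard, h3]
    obtain ⟨u, v, huv, hdiff⟩ := Set.ncard_eq_two.1 h2
    have hmem : ∀ g, (g ∈ S ∧ ¬ (g = x ∨ g = y ∨ g = z)) ↔ (g = u ∨ g = v) := fun g => by
      have := Set.ext_iff.1 hdiff g
      simpa using this
    have hu := (hmem u).2 (.inl rfl)
    have hv := (hmem v).2 (.inr rfl)
    push Not at hu hv
    have hSeq : ∀ g, g ∈ S ↔ g = x ∨ g = y ∨ g = z ∨ g = u ∨ g = v := fun g => by
      have := hmem g
      constructor
      · tauto
      · rintro (rfl | rfl | rfl | rfl | rfl) <;> [exact hx; exact hy; exact hz; exact hu.1;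
          exact hv.1]
    clear hmem hdiff hsub h3 h2 hcard
    -- Besides `x * y = z`, the only possible relation says that `u * v` is one of `x`, `y`, `z`.
    -- Removing that element destroys both relations; if there is none, removing `x` suffices.
    by_cases c1 : u * v = z
    · refine ⟨z, x, y, u, v, ?_, ?_⟩
      · ext g
        simp only [hSeq, Set.mem_insert_iff, Set.mem_singleton_iff]
        tauto
      · simp only [Set.mem_insert_iff, Set.mem_singleton_iff, hzdef, c1]
        grind
    by_cases c2 : u * v = y
    · refine ⟨y, x, z, u, v, ?_, ?_⟩
      · ext g
        simp only [hSeq, Set.mem_insert_iff, Set.mem_singleton_iff]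
        tauto
      · simp only [Set.mem_insert_iff, Set.mem_singleton_iff, e1, c2]
        grind
    · refine ⟨x, y, z, u, v, ?_, ?_⟩
      · ext g
        simp only [hSeq, Set.mem_insert_iff, Set.mem_singleton_iff]
      · simp only [Set.mem_insert_iff, Set.mem_singleton_iff, e2]
        grind
  · push Not at h
    obtain ⟨e, S₁, he, rfl, h4⟩ := Set.eq_insert_of_ncard_eq_succ hcard
    obtain ⟨a, S₂, ha, rfl, h3⟩ := Set.eq_insert_of_ncard_eq_succ h4
    obtain ⟨b, c, d, hbc, hbd, hcd, rfl⟩ := Set.ncard_eq_three.1 h3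
    refine ⟨e, a, b, c, d, rfl, he, ?_⟩
    have hab : a ≠ b := fun h => ha (by simp [h])
    have hac : a ≠ c := fun h => ha (by simp [h])
    have had : a ≠ d := fun h => ha (by simp [h])
    have h1 := h a (by simp) b (by simp) hab
    have h2 := h c (by simp) d (by simp) hcd
    refine ⟨hab, hcd, hac, had, hbc, hbd, ?_, ?_, ?_, ?_⟩ <;> intro k
    · exact h1 (by simp [k])
    · exact h1 (by simp [k])
    · exact h2 (by simp [k])
    · exact h2 (by simp [k])

end Cayley

/-! ### The cases of the connection set -/

section Cayley

variable {Γ : Type*} [CommGroup Γ]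

lemma hasSpanningDecomposition_of_involutions [Finite Γ] {S : Set Γ} (hcard : S.ncard = 5)
    (one_notMem : (1 : Γ) ∉ S) (inv_mem : ∀ s ∈ S, s⁻¹ ∈ S)
    (connected : (SimpleGraph.mulCayley S).Connected) (hS : ∀ x ∈ S, x * x = 1) :
    (SimpleGraph.mulCayley S).HasSpanningDecomposition := by
  obtain ⟨e, a, b, c, d, rfl, he, hab, hcd, hac, had, hbc, hbd, h1, h2, h3, h4⟩ :=
    exists_four_involutions hcard one_notMem hS
  have ha := hS a (by simp)
  have hb := hS b (by simp)
  have hc := hS c (by simp)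
  have hd := hS d (by simp)
  refine hasSpanningDecomposition_of_isPairWalk rfl one_notMem inv_mem connected
    (hS e (by simp)) he (isPairWalk_alternatingWalk ha hb hab)
    (isPairWalk_alternatingWalk hc hd hcd) (fun i j hij => ?_) hac had
  have eq : alternatingWalk a b i = alternatingWalk c d j := by
    have hj : alternatingWalk c d j * alternatingWalk c d j = 1 := by
      rw [alternatingWalk, mul_mul_mul_comm, ← mul_zpow, ← mul_zpow, hc, hd, one_zpow, one_zpow,
        mul_one]
    exact mul_right_cancel (hij.trans hj.symm)
  have ha1 : a ≠ 1 := fun h => one_notMem (by simp [h])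
  have hb1 : b ≠ 1 := fun h => one_notMem (by simp [h])
  have hc1 : c ≠ 1 := fun h => one_notMem (by simp [h])
  have hd1 : d ≠ 1 := fun h => one_notMem (by simp [h])
  rcases alternatingWalk_mem ha hb i with ⟨p, hi⟩ | ⟨-, hi⟩ <;>
    rcases alternatingWalk_mem hc hd j with ⟨p', hj⟩ | ⟨-, hj⟩
  · exact ⟨p, p'⟩
  -- Unless both indices are even, the equality says that one of the four elements is `1`, that two
  -- of them from different pairs coincide, or that one is the product of the opposite pair.
  all_goals
    exfalso
    rcases hi with hi | hi <;> rcases hj with hj | hj <;> rw [hi, hj] at eq <;>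
      first
        | exact ha1 eq
        | exact hb1 eq
        | exact hc1 eq.symm
        | exact hd1 eq.symm
        | exact hac eq
        | exact had eq
        | exact hbc eq
        | exact hbd eq
        | exact h1 eq
        | exact h2 eq
        | exact h3 eq.symm
        | exact h4 eq.symm

lemma hasSpanningDecomposition_of_not_involution [Finite Γ] {S : Set Γ} (hcard : S.ncard = 5)
    (one_notMem : (1 : Γ) ∉ S) (inv_mem : ∀ s ∈ S, s⁻¹ ∈ S)
    (connected : (SimpleGraph.mulCayley S).Connected) {x : Γ} (hx : x ∈ S) (hx2 : x * x ≠ 1) :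
    (SimpleGraph.mulCayley S).HasSpanningDecomposition := by
  have ne_inv : ∀ {y : Γ}, y * y ≠ 1 → y ≠ y⁻¹ := fun h h' => h (by
    nth_rw 2 [h']; exact mul_inv_cancel _)
  have h3 : (S \ {x, x⁻¹}).ncard = 3 := by
    rw [Set.ncard_sdiff (by rintro g (rfl | rfl); exacts [hx, inv_mem _ hx]), hcard,
      Set.ncard_pair (ne_inv hx2)]
  have inv_mem' : ∀ g ∈ S \ {x, x⁻¹}, g⁻¹ ∈ S \ {x, x⁻¹} := by
    rintro g ⟨hg, hg'⟩
    refine ⟨inv_mem g hg, fun h => hg' ?_⟩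
    rcases h with h | h
    · exact .inr (by rw [← h, inv_inv]; rfl)
    · exact .inl (inv_injective h)
  have hSx : ∀ g, g ∈ S ↔ g ∈ S \ {x, x⁻¹} ∨ g = x ∨ g = x⁻¹ := by
    intro g
    constructor
    · intro hg
      by_cases h : g = x ∨ g = x⁻¹
      · exact .inr h
      · exact .inl ⟨hg, h⟩
    · rintro (h | rfl | rfl)
      exacts [h.1, hx, inv_mem _ hx]
  by_cases h : ∃ y ∈ S \ {x, x⁻¹}, y * y ≠ 1
  · obtain ⟨y, hy, hy2⟩ := h
    have hsub : ({y, y⁻¹} : Set Γ) ⊆ S \ {x, x⁻¹} := by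
      rintro g (rfl | rfl)
      exacts [hy, inv_mem' _ hy]
    have h1 : ((S \ {x, x⁻¹}) \ {y, y⁻¹}).ncard = 1 := by
      rw [Set.ncard_sdiff hsub, h3, Set.ncard_pair (ne_inv hy2)]
    obtain ⟨e, he⟩ := Set.ncard_eq_one.1 h1
    have hmem : ∀ g, (g ∈ S \ {x, x⁻¹} ∧ ¬ (g = y ∨ g = y⁻¹)) ↔ g = e := fun g => by
      have := Set.ext_iff.1 he g
      simpa using this
    obtain ⟨he1, he2⟩ := (hmem e).2 rfl
    -- The set left after removing both inverse pairs is closed under inverses and has the single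
    -- element `e`.
    have he_inv : e⁻¹ = e := (hmem e⁻¹).1 ⟨inv_mem' e he1, fun h => he2 (h.symm.imp
      (fun h => inv_injective h) fun h => by rw [← h, inv_inv])⟩
    have hyx : ¬ (y = x ∨ y = x⁻¹) := hy.2
    have hex : ¬ (e = x ∨ e = x⁻¹) := he1.2
    refine hasSpanningDecomposition_of_isPairWalk (e := e) (a := x) (a' := x⁻¹) (b := y)
      (b' := y⁻¹) ?_ one_notMem inv_mem connected ?_ ?_ (isPairWalk_zpow hx2) (isPairWalk_zpow hy2)
      (fun _ _ _ => ⟨one_dvd _, one_dvd _⟩) (fun h => hyx (.inl h.symm))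
      (fun h => hyx (.inr (by rw [h, inv_inv])))
    · ext g
      rw [hSx]
      have h4 := hmem g
      have h5 : g = y ∨ g = y⁻¹ → g ∈ S \ {x, x⁻¹} := fun h => hsub h
      simp only [Set.mem_insert_iff, Set.mem_singleton_iff]
      clear * - h4 h5
      tauto
    · nth_rw 1 [← he_inv]
      exact inv_mul_cancel e
    · simp only [Set.mem_insert_iff, Set.mem_singleton_iff]
      tauto
  · push Not at h
    have ne_one : ∀ g ∈ S \ {x, x⁻¹}, g ≠ 1 := fun g hg h => one_notMem (h ▸ hg.1)
    have uniq : ∀ g ∈ S \ {x, x⁻¹}, ∀ g' ∈ S \ {x, x⁻¹}, g ∈ Subgroup.zpowers x →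
        g' ∈ Subgroup.zpowers x → g = g' := fun g hg g' hg' k k' =>
      eq_of_mem_zpowers_of_mul_self k k' (h g hg) (h g' hg') (ne_one g hg) (ne_one g' hg')
    -- The cyclic group generated by `x` contains at most one of the three involutions. If there is
    -- one, it is taken as `e`, so that `a` and `b` lie outside.
    obtain ⟨e, a, b, hea, heb, hab, hset, haZ, hbZ⟩ : ∃ e a b, e ≠ a ∧ e ≠ b ∧ a ≠ b ∧
        S \ {x, x⁻¹} = {e, a, b} ∧ a ∉ Subgroup.zpowers x ∧ b ∉ Subgroup.zpowers x := by
      obtain ⟨a, b, c, hab, hac, hbc, hset⟩ := Set.ncard_eq_three.1 h3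
      have ha : a ∈ S \ {x, x⁻¹} := by simp [hset]
      have hb : b ∈ S \ {x, x⁻¹} := by simp [hset]
      have hc : c ∈ S \ {x, x⁻¹} := by simp [hset]
      by_cases ka : a ∈ Subgroup.zpowers x
      · exact ⟨a, b, c, hab, hac, hbc, hset, fun k => hab (uniq a ha b hb ka k),
          fun k => hac (uniq a ha c hc ka k)⟩
      by_cases kb : b ∈ Subgroup.zpowers x
      · exact ⟨b, a, c, hab.symm, hbc, hac, by rw [hset, Set.insert_comm], ka,
          fun k => hbc (uniq b hb c hc kb k)⟩
      · exact ⟨c, a, b, hac.symm, hbc.symm, hab, by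
          rw [hset, Set.pair_comm b c, Set.insert_comm], ka, kb⟩
    have hmem : ∀ g, (g ∈ S ∧ ¬ (g = x ∨ g = x⁻¹)) ↔ g = e ∨ g = a ∨ g = b := fun g => by
      have := Set.ext_iff.1 hset g
      simpa using this
    have he := (hmem e).2 (.inl rfl)
    have ha := (hmem a).2 (.inr (.inl rfl))
    have hb := (hmem b).2 (.inr (.inr rfl))
    have ha2 := h a ha
    have hb2 := h b hb
    refine hasSpanningDecomposition_of_isPairWalk (e := e) (a := a) (a' := b) (b := x)
      (b' := x⁻¹) ?_ one_notMem inv_mem connected (h e he) ?_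
      (isPairWalk_alternatingWalk ha2 hb2 hab) (isPairWalk_zpow hx2) (fun i j hij => ?_)
      (fun h => ha.2 (.inl h)) (fun h => ha.2 (.inr h))
    · ext g
      rw [hSx, hset]
      simp only [Set.mem_insert_iff, Set.mem_singleton_iff, or_assoc]
    · simp only [Set.mem_insert_iff, Set.mem_singleton_iff]
      tauto
    · refine ⟨?_, one_dvd _⟩
      have hZ : alternatingWalk a b i ∈ Subgroup.zpowers x := by
        rw [eq_inv_of_mul_eq_one_left hij]
        exact Subgroup.inv_mem _ (Subgroup.zpow_mem_zpowers x j)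
      -- At an odd index the alternating walk is at `a` or `b`, neither of which is a power of `x`.
      rcases alternatingWalk_mem ha2 hb2 i with ⟨p, -⟩ | ⟨-, hi | hi⟩
      · exact p
      · exact absurd (hi ▸ hZ) haZ
      · exact absurd (hi ▸ hZ) hbZ

end Cayley

/-- Every connected `5`-regular Cayley graph on a finite abelian group (with connection set `S`
closed under inverses and not containing the identity) decomposes into two Hamilton cycles and a
perfect matching. -/
theorem mainTheorem8 {Γ : Type*} [CommGroup Γ] [Finite Γ] [DecidableEq Γ] (S : Set Γ)
    (one_notMem : (1 : Γ) ∉ S) (inv_mem : ∀ s ∈ S, s⁻¹ ∈ S)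
    [(SimpleGraph.mulCayley S).LocallyFinite]
    (connected : (SimpleGraph.mulCayley S).Connected)
    (regular : (SimpleGraph.mulCayley S).IsRegularOfDegree 5) :
    (SimpleGraph.mulCayley S).HasTwoHamiltonCyclesMatchingDecomposition := by
  have hcard : S.ncard = 5 := by
    have hN : (SimpleGraph.mulCayley S).neighborSet 1 = S := by
      ext g
      rw [SimpleGraph.mem_neighborSet, mulCayley_adj_iff_exists one_notMem inv_mem]
      simp
    rw [← regular 1, ← SimpleGraph.card_neighborSet_eq_degree, ← Nat.card_eq_fintype_card,
      Nat.card_coe_set_eq, hN]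
  apply SimpleGraph.HasSpanningDecomposition.hasTwoHamiltonCyclesMatchingDecomposition
  by_cases h : ∃ x ∈ S, x * x ≠ 1
  · obtain ⟨x, hx, hx2⟩ := h
    exact hasSpanningDecomposition_of_not_involution hcard one_notMem inv_mem connected hx hx2
  · push Not at h
    exact hasSpanningDecomposition_of_involutions hcard one_notMem inv_mem connected h
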